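/- Let $k$ be a perfect field, let $r\ge 3$, let $A_1,\dots,A_r$ be abelian varieties over $k$, and let $L/k$ be a finite extension. **Notation.** For an embedding $E\hookrightarrow F$ of finite extensions of $k$ and an abelian variety $A$ over $k$, let $\mathrm{res}_{F/E}:A(E)\to A(F)$ be the restriction map (precomposition with $\mathrm{Spec}\,F\to\mathrm{Spec}\,E$), and let $N_{F/E}:A(F)\to A(E)$ be the norm map: $N_{F/E}(a)$ is the unique point of $A(E)$ whose image in $A(\overline E)$ is $\sum_\sigma\sigma(a)$, where $\sigma$ runs over the $E$-embeddings $F\to\overline E$. For abelian varieties $B_1,\dots,B_s$ over $k$, the Somekawa $K$-group $K(k;B_1,\dots,B_s)$ is the quotient of $\bigoplus_{F/k\text{ finite}}B_1(F)\otimes\cdots\otimes B_s(F)$ by the following two types of relations, where $\{b_1,\dots,b_s\}_{F/k}$ denotes the class of $b_1\otimes\cdots\otimes b_s$ in the summand of $F$. * *(Projection formula)* For every tower $F/E/k$ of finite extensions, every index $i$, every $b_i\in B_i(F)$ and all $b_j\in B_j(E)$ $(j\ne i)$: $$\{b_1,\dots,N_{F/E}(b_i),\dots,b_s\}_{E/k}=\{\mathrm{res}_{F/E}(b_1),\dots,b_i,\dots,\mathrm{res}_{F/E}(b_s)\}_{F/k}.$$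 * *(Weil reciprocity)* For every smooth projective (integral, not necessarily geometrically connected) curve $C$ over $k$, all morphisms $g_i:C\to B_i$ over $k$ and every $f\in k(C)^\times$: $$\sum_{x}\mathrm{ord}_x(f)\,\{g_1\circ\iota_x,\dots,g_s\circ\iota_x\}_{k(x)/k}=0,$$ where $x$ runs over the closed points of $C$ and $\iota_x:\mathrm{Spec}\,k(x)\to C$ is the canonical inclusion. For a finite extension $F/k$, let $L_1,\dots,L_n$ be the factors of $F\otimes_kL\simeq\prod_{j=1}^nL_j$, i.e. the quotients of $F\otimes_k L$ by its maximal ideals. These are fields, finite over $k$, and the maps $F\to F\otimes_kL\to L_j$ and $L\to F\otimes_kL\to L_j$ make them extensions of $F$ and of $L$. **Proposition.** There is a unique (well-defined) group homomorphism $$\Phi:\ K(k;A_1,A_2)\otimes A_3(L)\otimes\cdots\otimes A_r(L)\longrightarrow K(k;A_1,\dots,A_r)$$ such that, for every finite extension $F/k$, all $a_1\in A_1(F)$, $a_2\in A_2(F)$ and all $a_i\in A_i(L)$ for $3\le i\le r$, $$\Phi\bigl(\{a_1,a_2\}_{F/k}\otimes a_3\otimes\cdots\otimes a_r\bigr)=\sum_{j=1}^n\{\mathrm{res}_{L_j/F}(a_1),\mathrm{res}_{L_j/F}(a_2),\mathrm{res}_{L_j/L}(a_3),\dots,\mathrm{res}_{L_j/L}(a_r)\}_{L_j/k}.$$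 -/

import Mathlib

open CategoryTheory AlgebraicGeometry
open scoped TensorProduct DirectSum

universe u

noncomputable section

namespace Somekawa

/-! ### Abelian varieties and their points -/

/-- An abelian variety over a field `k`: a proper, geometrically integral group scheme over
`Spec k`. (Such a group scheme is automatically smooth and commutative.) -/
structure AbelianVariety (k : Type u) [Field k] where
  /-- the underlying `k`-scheme -/
  scheme : Over (Spec (.of k))
  [grpObj : GrpObj scheme]
  [isProper : IsProper scheme.hom]
  [geometricallyIntegral : GeometricallyIntegral scheme.hom]

attribute [instance] AbelianVariety.grpObj AbelianVariety.isProper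
  AbelianVariety.geometricallyIntegral

/-- `Spec F`, viewed as a `k`-scheme. -/
abbrev specOver (k F : Type u) [Field k] [Field F] [Algebra k F] : Over (Spec (.of k)) :=
  Over.mk (Spec.map (CommRingCat.ofHom (algebraMap k F)))

/-- The morphism `Spec F ⟶ Spec E` of `k`-schemes attached to a `k`-embedding `E → F`. -/
abbrev specMap {k E F : Type u} [Field k] [Field E] [Algebra k E] [Field F] [Algebra k F]
    (φ : E →ₐ[k] F) : specOver k F ⟶ specOver k E :=
  Over.homMk (Spec.map (CommRingCat.ofHom φ.toRingHom)) (by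
    simp only [Over.mk_left, Over.mk_hom, ← Spec.map_comp, ← CommRingCat.ofHom_comp]
    congr 2
    exact φ.comp_algebraMap)

namespace AbelianVariety

open scoped MonObj

variable {k : Type u} [Field k] (A : AbelianVariety k)

instance isCommMonObj : IsCommMonObj A.scheme :=
  isCommMonObj_of_isProper_of_geometricallyIntegral A.scheme

/-- The group `A(F)` of `F`-rational points, i.e. of morphisms `Spec F ⟶ A` over `Spec k`,
written additively. -/
def Point (F : Type u) [Field F] [Algebra k F] : Type u :=
  Additive (specOver k F ⟶ A.scheme)

instance (F : Type u) [Field F] [Algebra k F] : AddCommGroup (A.Point F) :=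
  inferInstanceAs (AddCommGroup (Additive (specOver k F ⟶ A.scheme)))

variable {A}

/-- A morphism `Spec F ⟶ A` over `Spec k`, regarded as an element of `A(F)`. -/
def Point.ofHom {F : Type u} [Field F] [Algebra k F] (p : specOver k F ⟶ A.scheme) : A.Point F :=
  Additive.ofMul p

/-- An element of `A(F)`, regarded as a morphism `Spec F ⟶ A` over `Spec k`. -/
def Point.toHom {F : Type u} [Field F] [Algebra k F] (p : A.Point F) : specOver k F ⟶ A.scheme :=
  Additive.toMul p

variable {E F G : Type u} [Field E] [Algebra k E] [Field F] [Algebra k F] [Field G] [Algebra k G]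

/-- The restriction map `A(E) → A(F)` along a `k`-embedding `φ : E → F`: precomposition with
`Spec F ⟶ Spec E`. -/
def res (φ : E →ₐ[k] F) : A.Point E →+ A.Point F where
  toFun p := .ofHom (specMap φ ≫ p.toHom)
  map_zero' := congrArg Point.ofHom (MonObj.comp_one (specMap φ))
  map_add' p q := congrArg Point.ofHom (MonObj.comp_mul (specMap φ) p.toHom q.toHom)

theorem res_comp (φ : E →ₐ[k] F) (ψ : F →ₐ[k] G) (p : A.Point E) :
    res (ψ.comp φ) p = res ψ (res φ p) := by
  have h : specMap (ψ.comp φ) = specMap ψ ≫ specMap φ := by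
    ext1
    simp only [Over.homMk_left, Over.comp_left, ← Spec.map_comp, ← CommRingCat.ofHom_comp]
    rfl
  refine congrArg Point.ofHom ?_
  rw [h, Category.assoc]
  rfl

theorem res_injective (φ : E →ₐ[k] F) : Function.Injective (res (A := A) φ) := by
  intro p q h
  have h' : specMap φ ≫ p.toHom = specMap φ ≫ q.toHom := h
  have : Flat (Spec.map (CommRingCat.ofHom φ.toRingHom)) := by
    rw [Flat.SpecMap_iff]
    let := φ.toRingHom.toAlgebra
    exact inferInstanceAs (Module.Flat E F)
  have : Surjective (Spec.map (CommRingCat.ofHom φ.toRingHom)) :=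
    ⟨Function.surjective_to_subsingleton (α := PrimeSpectrum F) (β := PrimeSpectrum E) _⟩
  have : Epi (Spec.map (CommRingCat.ofHom φ.toRingHom)) := Flat.epi_of_flat_of_surjective _
  have h2 : p.toHom = q.toHom := by
    ext1
    exact (cancel_epi (Spec.map (CommRingCat.ofHom φ.toRingHom))).mp (congrArg CommaMorphism.left h')
  exact h2

/-! ### The norm map -/

/-- The embeddings `σ : F → Ē` into an algebraic closure `Ē` of `E` that restrict along
`φ : E → F` to the inclusion `E → Ē`. -/
abbrev Embedding (φ : E →ₐ[k] F) : Type u :=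
  {σ : F →ₐ[k] AlgebraicClosure E // σ.comp φ = IsScalarTower.toAlgHom k E (AlgebraicClosure E)}

instance [FiniteDimensional k F] (φ : E →ₐ[k] F) : Fintype (Embedding φ) :=
  Fintype.ofFinite _

/-- The sum `∑_σ σ(a)`, in `A(Ē)`, of the conjugates over `E` of a point `a ∈ A(F)`. -/
def conjSum [FiniteDimensional k F] (φ : E →ₐ[k] F) (a : A.Point F) :
    A.Point (AlgebraicClosure E) :=
  ∑ σ : Embedding φ, res σ.1 a

/-- The sum of the conjugates is invariant under `Aut(Ē / E)`. -/
theorem res_conjSum [FiniteDimensional k F] (φ : E →ₐ[k] F) (a : A.Point F)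
    (τ : AlgebraicClosure E ≃ₐ[E] AlgebraicClosure E) :
    res (τ.toAlgHom.restrictScalars k) (conjSum φ a) = conjSum φ a := by
  have hcomm (τ : AlgebraicClosure E ≃ₐ[E] AlgebraicClosure E) :
      (τ.toAlgHom.restrictScalars k).comp (IsScalarTower.toAlgHom k E (AlgebraicClosure E)) =
        IsScalarTower.toAlgHom k E (AlgebraicClosure E) := by
    ext e
    exact τ.commutes e
  let f (τ : AlgebraicClosure E ≃ₐ[E] AlgebraicClosure E) (σ : Embedding φ) : Embedding φ :=
    ⟨(τ.toAlgHom.restrictScalars k).comp σ.1, by rw [AlgHom.comp_assoc, σ.2, hcomm]⟩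
  have hf (τ : AlgebraicClosure E ≃ₐ[E] AlgebraicClosure E) (σ : Embedding φ) :
      f τ.symm (f τ σ) = σ :=
    Subtype.ext (AlgHom.ext fun x ↦ τ.symm_apply_apply (σ.1 x))
  let e : Embedding φ ≃ Embedding φ := ⟨f τ, f τ.symm, hf τ, hf τ.symm⟩
  have h1 : res (τ.toAlgHom.restrictScalars k) (conjSum φ a) = ∑ σ, res (e σ).1 a := by
    rw [conjSum, map_sum]
    exact Finset.sum_congr rfl fun σ _ ↦ (res_comp σ.1 (τ.toAlgHom.restrictScalars k) a).symm
  rw [h1, Equiv.sum_comp e (fun σ ↦ res σ.1 a), conjSum]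

/-- A point over `Ē` that is invariant under `Aut(Ē / E)` comes from a point over `E`. -/
theorem exists_res_eq_of_forall_res_eq [PerfectField E] (p : A.Point (AlgebraicClosure E))
    (hp : ∀ τ : AlgebraicClosure E ≃ₐ[E] AlgebraicClosure E,
      res (τ.toAlgHom.restrictScalars k) p = p) :
    ∃ b : A.Point E, res (IsScalarTower.toAlgHom k E (AlgebraicClosure E)) b = p := by
  obtain ⟨⟨x, ψ⟩, hψ⟩ :=
    (Scheme.SpecToEquivOfField (AlgebraicClosure E) A.scheme.left).symm.surjective p.toHom.left
  have hψ' : Spec.map ψ ≫ A.scheme.left.fromSpecResidueField x = p.toHom.left := hψ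
  have hfix (τ : AlgebraicClosure E ≃ₐ[E] AlgebraicClosure E) (z : A.scheme.left.residueField x) :
      τ (ψ.hom z) = ψ.hom z := by
    have h1 : specMap (τ.toAlgHom.restrictScalars k) ≫ p.toHom = p.toHom := hp τ
    have h2 : Spec.map (CommRingCat.ofHom (τ.toAlgHom.restrictScalars k).toRingHom) ≫
        p.toHom.left = p.toHom.left := congrArg Over.Hom.left h1
    have h3 : Spec.map (ψ ≫ CommRingCat.ofHom (τ.toAlgHom.restrictScalars k).toRingHom) =
        Spec.map ψ := by
      rw [← cancel_mono (A.scheme.left.fromSpecResidueField x), hψ', Spec.map_comp,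
        Category.assoc, hψ']
      exact h2
    exact congrArg (fun h ↦ h.hom z) (Spec.map_injective h3)
  have hmem (z : A.scheme.left.residueField x) :
      ψ.hom z ∈ (algebraMap E (AlgebraicClosure E)).range :=
    (InfiniteGalois.mem_range_algebraMap_iff_fixed (ψ.hom z)).mpr fun τ ↦ hfix τ z
  let e : E ≃+* (algebraMap E (AlgebraicClosure E)).range :=
    RingEquiv.ofBijective _ ⟨(algebraMap E (AlgebraicClosure E)).rangeRestrict.injective,
      (algebraMap E (AlgebraicClosure E)).rangeRestrict_surjective⟩
  let ψ₀ : A.scheme.left.residueField x ⟶ .of E :=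
    CommRingCat.ofHom (e.symm.toRingHom.comp (ψ.hom.codRestrict _ hmem))
  have hψ₀ : ψ₀ ≫ CommRingCat.ofHom (algebraMap E (AlgebraicClosure E)) = ψ := by
    ext z
    exact congrArg Subtype.val (e.apply_symm_apply (ψ.hom.codRestrict _ hmem z))
  have hfac : Spec.map (CommRingCat.ofHom (algebraMap E (AlgebraicClosure E))) ≫
      Spec.map ψ₀ ≫ A.scheme.left.fromSpecResidueField x = p.toHom.left := by
    rw [← Category.assoc, ← Spec.map_comp, hψ₀, hψ']
  have hover : (Spec.map ψ₀ ≫ A.scheme.left.fromSpecResidueField x) ≫ A.scheme.hom =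
      Spec.map (CommRingCat.ofHom (algebraMap k E)) := by
    obtain ⟨χ, hχ⟩ := Spec.map_surjective
      ((Spec.map ψ₀ ≫ A.scheme.left.fromSpecResidueField x) ≫ A.scheme.hom)
    have h1 : Spec.map (CommRingCat.ofHom (algebraMap E (AlgebraicClosure E))) ≫ Spec.map χ =
        Spec.map (CommRingCat.ofHom (algebraMap k (AlgebraicClosure E))) := by
      rw [hχ, ← Category.assoc, hfac]
      exact Over.w p.toHom
    rw [← Spec.map_comp] at h1
    have h2 := Spec.map_injective h1
    rw [← hχ]
    congr 1
    ext c
    apply (algebraMap E (AlgebraicClosure E)).injective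
    exact (congrArg (fun h ↦ h.hom c) h2).trans
      (IsScalarTower.algebraMap_apply k E (AlgebraicClosure E) c)
  refine ⟨.ofHom (Over.homMk (Spec.map ψ₀ ≫ A.scheme.left.fromSpecResidueField x) hover), ?_⟩
  have h : specMap (IsScalarTower.toAlgHom k E (AlgebraicClosure E)) ≫
      Over.homMk (Spec.map ψ₀ ≫ A.scheme.left.fromSpecResidueField x) hover = p.toHom := by
    ext1
    exact hfac
  exact h

/-- Galois descent for points: the sum of the conjugates comes from a unique point over `E`. -/
theorem existsUnique_res_eq_conjSum [PerfectField k] [FiniteDimensional k E]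
    [FiniteDimensional k F] (φ : E →ₐ[k] F) (a : A.Point F) :
    ∃! b : A.Point E,
      res (IsScalarTower.toAlgHom k E (AlgebraicClosure E)) b = conjSum φ a := by
  have : PerfectField E := Algebra.IsAlgebraic.perfectField k
  obtain ⟨b, hb⟩ := exists_res_eq_of_forall_res_eq (conjSum φ a) fun τ ↦ res_conjSum φ a τ
  exact ⟨b, hb, fun b' hb' ↦ res_injective _ (hb'.trans hb.symm)⟩

/-- The norm (trace) map `A(F) → A(E)` along a `k`-embedding `φ : E → F` of finite extensions of
the perfect field `k`: the point of `A(E)` that becomes, over `Ē`, the sum of the conjugates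
of `a`. -/
def norm [PerfectField k] [FiniteDimensional k E] [FiniteDimensional k F]
    (φ : E →ₐ[k] F) (a : A.Point F) : A.Point E :=
  (existsUnique_res_eq_conjSum φ a).choose

theorem res_norm [PerfectField k] [FiniteDimensional k E] [FiniteDimensional k F]
    (φ : E →ₐ[k] F) (a : A.Point F) :
    res (IsScalarTower.toAlgHom k E (AlgebraicClosure E)) (norm φ a) = conjSum φ a :=
  (existsUnique_res_eq_conjSum φ a).choose_spec.1

end AbelianVariety

/-! ### Finite extensions and the Mackey product -/

/-- A finite extension `F / k`, i.e. a field `F` with a chosen finite embedding `k → F`. -/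
structure FinExt (k : Type u) [Field k] : Type (u + 1) where
  /-- the field -/
  carrier : Type u
  [field : Field carrier]
  [algebra : Algebra k carrier]
  [finiteDimensional : FiniteDimensional k carrier]

instance (k : Type u) [Field k] : CoeSort (FinExt k) (Type u) := ⟨FinExt.carrier⟩

attribute [instance] FinExt.field FinExt.algebra FinExt.finiteDimensional

section MackeyProduct

variable {k : Type u} [Field k] {I : Type} [DecidableEq I] (A : I → AbelianVariety k)

/-- The group `⨁_{F/k finite} ⨂_i A_i(F)`. -/
abbrev TensorSum : Type (u + 1) :=
  ⨁ F : FinExt k, ⨂[ℤ] i, (A i).Point F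

/-- The pure tensor `⨂_i a_i` in the summand of `F`. -/
def pureTensor (F : FinExt k) (a : ∀ i, (A i).Point F) : TensorSum A :=
  letI := Classical.decEq (FinExt k)
  DirectSum.of (fun F : FinExt k ↦ ⨂[ℤ] i, (A i).Point F) F (PiTensorProduct.tprod ℤ a)

variable [PerfectField k]

/-- The subgroup generated by the projection formula: for an embedding `φ : E → F` over `k`, an
index `i`, a point `x ∈ A_i(F)` and points `a_j ∈ A_j(E)` for `j ≠ i`,
`a_1 ⊗ ⋯ ⊗ N(x) ⊗ ⋯ ⊗ a_r - res a_1 ⊗ ⋯ ⊗ x ⊗ ⋯ ⊗ res a_r`, with `N(x)` and `x` in place `i`.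
(The entry `a i` of the family `a` is not used.) -/
def projectionFormula : AddSubgroup (TensorSum A) :=
  AddSubgroup.closure {t | ∃ (E F : FinExt k) (φ : E →ₐ[k] F) (i : I) (x : (A i).Point F)
    (a : ∀ j, (A j).Point E),
    t = pureTensor A E (Function.update a i (AbelianVariety.norm φ x)) -
      pureTensor A F (Function.update (fun j ↦ AbelianVariety.res φ (a j)) i x)}

/-- The Mackey product `(A_1 ⊗^M ⋯ ⊗^M A_r)(k)`. -/
abbrev MackeyProduct : Type (u + 1) :=
  TensorSum A ⧸ projectionFormula A

/-- The symbol `{a_1, …, a_r}_{F/k}` in the Mackey product. -/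
def mackeySymbol (F : FinExt k) (a : ∀ i, (A i).Point F) : MackeyProduct A :=
  QuotientAddGroup.mk (pureTensor A F a)

end MackeyProduct

/-! ### Curves, Weil reciprocity and the Somekawa `K`-group -/

/-- A smooth projective curve over `k`: an integral scheme that is smooth of relative dimension one
and proper over `Spec k`. (For curves over a field, proper and projective are the same. The curve
is not required to be geometrically connected.) -/
class IsSmoothProjectiveCurve {k : Type u} [Field k] (C : Over (Spec (.of k))) : Prop where
  isIntegral : IsIntegral C.left
  isProper : IsProper C.hom
  smooth : SmoothOfRelativeDimension 1 C.hom

attribute [instance] IsSmoothProjectiveCurve.isIntegral IsSmoothProjectiveCurve.isProper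
  IsSmoothProjectiveCurve.smooth

section Curve

variable {k : Type u} [Field k] (C : Over (Spec (.of k))) [IsSmoothProjectiveCurve C]

instance isLocallyNoetherian_curve : IsLocallyNoetherian C.left :=
  LocallyOfFiniteType.isLocallyNoetherian C.hom

/-- The closed points of `C`. -/
abbrev ClosedPoint : Type u := {x : C.left // IsClosed {x}}

variable {C}

/-- The residue field `k(x)` of a closed point `x`, a finite extension of `k` through
`Spec k(x) ⟶ C ⟶ Spec k`. -/
def residueExt (x : ClosedPoint C) : FinExt k :=
  letI : Algebra k (C.left.residueField x.1) :=
    (Spec.preimage (C.left.fromSpecResidueField x.1 ≫ C.hom)).hom.toAlgebra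
  { carrier := C.left.residueField x.1
    finiteDimensional := by
      have h : IsFinite (C.left.fromSpecResidueField x.1 ≫ C.hom) := by
        have hx := x.2
        have := (isClosed_singleton_iff_isClosedImmersion).mp hx
        have : LocallyOfFiniteType C.hom := inferInstance
        rw [isFinite_iff_locallyOfFiniteType_of_jacobsonSpace]
        infer_instance
      rw [← Spec.map_preimage (C.left.fromSpecResidueField x.1 ≫ C.hom),
        IsFinite.SpecMap_iff] at h
      exact h }

/-- The canonical inclusion `ι_x : Spec k(x) ⟶ C`, a morphism over `Spec k`. -/
def inclusion (x : ClosedPoint C) : specOver k (residueExt x) ⟶ C :=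
  Over.homMk (C.left.fromSpecResidueField x.1) (Spec.map_preimage _).symm

end Curve

section KGroup

variable {k : Type u} [Field k] [PerfectField k] {I : Type} [DecidableEq I]
  (A : I → AbelianVariety k)

/-- The subgroup of the Mackey product generated by Weil reciprocity: for a smooth projective
curve `C` over `k`, morphisms `g_i : C ⟶ A_i` over `k` and a nonzero rational function `f` on `C`,
the element `∑_x ord_x(f) {g_1 ∘ ι_x, …, g_r ∘ ι_x}_{k(x)/k}`, summed over the closed points of
`C`; since almost all `ord_x(f)` vanish, the sum is taken over any finite set `S` of closed points
that contains all those with `ord_x(f) ≠ 0`. -/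
def weilReciprocity : AddSubgroup (MackeyProduct A) :=
  AddSubgroup.closure {t | ∃ (C : Over (Spec (.of k))) (_ : IsSmoothProjectiveCurve C)
    (g : ∀ i, C ⟶ (A i).scheme) (f : C.left.functionField) (S : Finset (ClosedPoint C)),
    f ≠ 0 ∧ (∀ x : ClosedPoint C, Scheme.ord f x.1 ≠ 0 → x ∈ S) ∧
    t = ∑ x ∈ S, Scheme.ord f x.1 •
      mackeySymbol A (residueExt x) (fun i ↦ .ofHom (inclusion x ≫ g i))}

/-- The Somekawa `K`-group `K(k; A_1, …, A_r)`. -/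
abbrev KGroup : Type (u + 1) :=
  MackeyProduct A ⧸ weilReciprocity A

/-- The symbol `{a_1, …, a_r}_{F/k}` in `K(k; A_1, …, A_r)`. -/
def symbol (F : FinExt k) (a : ∀ i, (A i).Point F) : KGroup A :=
  QuotientAddGroup.mk (mackeySymbol A F a)

end KGroup

/-! ### The factors of `F ⊗_k L` -/

section Factors

variable {k : Type u} [Field k] (F L : FinExt k)

/-- The set indexing the factors `L_j` of `F ⊗_k L ≃ ∏ L_j`: the maximal ideals of the
finite-dimensional `k`-algebra `F ⊗_k L`. -/
abbrev FactorIndex : Type u := MaximalSpectrum (F ⊗[k] L)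

instance : Finite (FactorIndex F L) :=
  haveI : IsArtinianRing (F ⊗[k] L) := IsArtinianRing.of_finite k (F ⊗[k] L)
  inferInstance

instance : Fintype (FactorIndex F L) := Fintype.ofFinite _

variable {F L}

/-- The factor `L_j` of `F ⊗_k L`, the quotient by the `j`-th maximal ideal, as a finite
extension of `k`. -/
def factor (j : FactorIndex F L) : FinExt k :=
  letI : Field ((F ⊗[k] L) ⧸ j.asIdeal) :=
    haveI := j.isMaximal
    Ideal.Quotient.field j.asIdeal
  { carrier := (F ⊗[k] L) ⧸ j.asIdeal
    algebra := Ideal.Quotient.algebra k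
    finiteDimensional := inferInstanceAs (Module.Finite k ((F ⊗[k] L) ⧸ j.asIdeal)) }

/-- The extension `L_j / F`. -/
def factorLeft (j : FactorIndex F L) : F →ₐ[k] factor j :=
  (Ideal.Quotient.mkₐ k j.asIdeal).comp Algebra.TensorProduct.includeLeft

/-- The extension `L_j / L`. -/
def factorRight (j : FactorIndex F L) : L →ₐ[k] factor j :=
  (Ideal.Quotient.mkₐ k j.asIdeal).comp Algebra.TensorProduct.includeRight

end Factors

end Somekawa

end

open Somekawa

/-! Fix points `b` over `L`. A symbol `{a}_{F/k}` is sent to the sum, over the factors `L_j` of `F ⊗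
L`, of the symbols of the restrictions of `a` and `b` to `L_j`. This is multilinear in `a` and in
`b`, so a homomorphism exists once the two families of relations are respected; it is unique because
symbols and pure tensors generate. The argument works for any number `n` of entries over `F`, and `n
= 2` is the case needed.

Projection formula. For `E → F`, every factor `F_l` of `F ⊗ L` lies over one factor `E_j` of `E ⊗
L`. The norm commutes with base change: the restriction of `N_{F/E}(x)` to `E_j` is the sum of the
norms from the `F_l` above `E_j` of the restrictions of `x` (`res_factorLeft_norm`), because the
embeddings of `F` over `E` into an algebraic closure of `E_j` are the embeddings over `E_j` of these
`F_l`. The projection formula for each `F_l / E_j` then gives the claim (`factorSum_update_norm`).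

Weil reciprocity. As `k` is perfect, `C ×_k L → C` is finite étale, so the irreducible components of
`C ×_k L` are disjoint smooth projective curves over `k`. The closed points above `x` correspond to
the factors of `k(x) ⊗ L`, with these factors as residue fields, and orders of vanishing are
unchanged by the étale pullback (`ord_functionFieldMap`). So the image of the relation for `(C, g,
f)` is the sum over the components of the relations for the pullbacks of `f` and `g` together with
the maps to `A_i` given by `b` (`sum_ord_smul_factorSum`). -/

noncomputable section

namespace Somekawa

/-! ### The norm over an arbitrary algebraically closed extension. -/

namespace AbelianVariety

variable {k : Type u} [Field k] {A : AbelianVariety k}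
  {E F G : Type u} [Field E] [Algebra k E] [Field F] [Algebra k F] [Field G] [Algebra k G]

/-- The embeddings `F → Ω` that restrict along `φ : E → F` to `ω : E → Ω`. -/
abbrev EmbeddingOver (φ : E →ₐ[k] F) (ω : E →ₐ[k] G) : Type u :=
  {σ : F →ₐ[k] G // σ.comp φ = ω}

instance [FiniteDimensional k F] (φ : E →ₐ[k] F) (ω : E →ₐ[k] G) :
    Fintype (EmbeddingOver φ ω) :=
  Fintype.ofFinite _

/-- The embeddings into an algebraically closed extension of `E` factor through `Ē`. -/
theorem exists_embedding_comp_eq [FiniteDimensional k F] (φ : E →ₐ[k] F) (ω : E →ₐ[k] G)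
    (j : AlgebraicClosure E →ₐ[k] G)
    (hj : j.comp (IsScalarTower.toAlgHom k E (AlgebraicClosure E)) = ω)
    (τ : EmbeddingOver φ ω) : ∃ σ : Embedding φ, j.comp σ.1 = τ.1 := by
  let _ : Algebra E F := φ.toRingHom.toAlgebra
  let _ : Algebra E G := ω.toRingHom.toAlgebra
  let _ : Algebra (AlgebraicClosure E) G := j.toRingHom.toAlgebra
  have : IsScalarTower k E F := .of_algebraMap_eq fun x ↦ (φ.commutes x).symm
  have : IsScalarTower k E G := .of_algebraMap_eq fun x ↦ (ω.commutes x).symm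
  have : IsScalarTower E (AlgebraicClosure E) G :=
    .of_algebraMap_eq fun x ↦ (DFunLike.congr_fun hj x).symm
  have : FiniteDimensional E F := FiniteDimensional.right k E F
  let τ' : F →ₐ[E] G := { τ.1 with commutes' := fun x ↦ DFunLike.congr_fun τ.2 x }
  -- Minimal polynomials over `E` split in `Ē`, so every `E`-embedding of `F` into `G` lands in `Ē`.
  let e := Algebra.IsAlgebraic.algHomEquivAlgHomOfSplits (F := E) (K := F) G (AlgebraicClosure E)
    fun x ↦ IsAlgClosed.splits _
  refine ⟨⟨(e.symm τ').restrictScalars k, AlgHom.ext fun x ↦ (e.symm τ').commutes x⟩, ?_⟩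
  ext x
  exact (Algebra.IsAlgebraic.algHomEquivAlgHomOfSplits_apply_apply G (AlgebraicClosure E)
    (fun x ↦ IsAlgClosed.splits _) (e.symm τ') x).symm.trans
    (DFunLike.congr_fun (e.apply_symm_apply τ') x)

/-- The defining property of the norm, over any algebraically closed extension of `E`. -/
theorem res_norm_eq_sum [PerfectField k] [FiniteDimensional k E] [FiniteDimensional k F]
    [IsAlgClosed G] (φ : E →ₐ[k] F) (ω : E →ₐ[k] G) (a : A.Point F) :
    res ω (norm φ a) = ∑ σ : EmbeddingOver φ ω, res σ.1 a := by
  let _ : Algebra E G := ω.toRingHom.toAlgebra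
  have : IsScalarTower k E G := .of_algebraMap_eq fun x ↦ (ω.commutes x).symm
  let j : AlgebraicClosure E →ₐ[k] G :=
    (IsAlgClosed.lift : AlgebraicClosure E →ₐ[E] G).restrictScalars k
  have hj : j.comp (IsScalarTower.toAlgHom k E (AlgebraicClosure E)) = ω :=
    AlgHom.ext fun x ↦ (IsAlgClosed.lift : AlgebraicClosure E →ₐ[E] G).commutes x
  rw [← hj, res_comp, res_norm, conjSum, map_sum]
  refine Finset.sum_bij' (fun σ _ ↦ ⟨j.comp σ.1, by rw [AlgHom.comp_assoc, σ.2]⟩)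
    (fun τ _ ↦ (exists_embedding_comp_eq φ _ j rfl τ).choose) (fun _ _ ↦ Finset.mem_univ _)
    (fun _ _ ↦ Finset.mem_univ _) (fun σ _ ↦ ?_) (fun τ _ ↦ ?_) (fun σ _ ↦ ?_)
  · refine Subtype.ext (AlgHom.ext fun x ↦ j.injective ?_)
    exact DFunLike.congr_fun (exists_embedding_comp_eq φ _ j rfl
      ⟨j.comp σ.1, by rw [AlgHom.comp_assoc, σ.2]⟩).choose_spec x
  · exact Subtype.ext (exists_embedding_comp_eq φ _ j rfl τ).choose_spec
  · exact (res_comp _ _ _).symm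

/-- The norm along an isomorphism is the inverse of the restriction. -/
theorem norm_res_algEquiv [PerfectField k] [FiniteDimensional k E] [FiniteDimensional k F]
    (e : E ≃ₐ[k] F) (a : A.Point E) : norm e.toAlgHom (res e.toAlgHom a) = a := by
  apply res_injective (IsScalarTower.toAlgHom k E (AlgebraicClosure E))
  rw [res_norm_eq_sum]
  -- For an isomorphism there is exactly one conjugate.
  let σ₀ : EmbeddingOver e.toAlgHom (IsScalarTower.toAlgHom k E (AlgebraicClosure E)) :=
    ⟨(IsScalarTower.toAlgHom k E (AlgebraicClosure E)).comp e.symm.toAlgHom, by ext; simp⟩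
  have h (σ : EmbeddingOver e.toAlgHom (IsScalarTower.toAlgHom k E (AlgebraicClosure E))) :
      σ = σ₀ := by
    refine Subtype.ext (AlgHom.ext fun x ↦ ?_)
    have := DFunLike.congr_fun σ.2 (e.symm x)
    simpa [σ₀] using this
  rw [Fintype.sum_eq_single σ₀ fun σ hσ ↦ (hσ (h σ)).elim, ← res_comp, σ₀.2]

end AbelianVariety

/-! ### Factors of `F ⊗ L`, and base change of the norm. -/

section Factors

variable {k : Type u} [Field k] {E F L : FinExt k}

/-- The projection `F ⊗_k L → L_j`. -/
def factorMk (j : FactorIndex F L) : (F ⊗[k] L) →ₐ[k] factor j :=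
  Ideal.Quotient.mkₐ k j.asIdeal

theorem factorMk_surjective (j : FactorIndex F L) : Function.Surjective (factorMk j) :=
  Ideal.Quotient.mk_surjective

theorem factorMk_eq_zero_iff (j : FactorIndex F L) (t : F ⊗[k] L) :
    factorMk j t = 0 ↔ t ∈ j.asIdeal :=
  Ideal.Quotient.eq_zero_iff_mem

/-- The homomorphism on `L_j` induced by one on `F ⊗_k L`. -/
def factorLift (j : FactorIndex F L) {K : Type u} [Field K] [Algebra k K]
    (f : (F ⊗[k] L) →ₐ[k] K) (hf : ∀ t ∈ j.asIdeal, f t = 0) : factor j →ₐ[k] K :=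
  Ideal.Quotient.liftₐ j.asIdeal f hf

theorem factor_hom_ext {j : FactorIndex F L} {K : Type u} [Field K] [Algebra k K]
    {f g : factor j →ₐ[k] K} (h₁ : f.comp (factorLeft j) = g.comp (factorLeft j))
    (h₂ : f.comp (factorRight j) = g.comp (factorRight j)) : f = g := by
  have h : f.comp (factorMk j) = g.comp (factorMk j) := Algebra.TensorProduct.ext h₁ h₂
  ext x
  obtain ⟨t, rfl⟩ := factorMk_surjective j x
  exact DFunLike.congr_fun h t

/-- The homomorphism `F ⊗_k L → K` given by homomorphisms on `F` and `L`. -/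
def tensorLift {K : Type u} [Field K] [Algebra k K] (f : F →ₐ[k] K) (g : L →ₐ[k] K) :
    (F ⊗[k] L) →ₐ[k] K :=
  Algebra.TensorProduct.lift f g fun _ _ ↦ mul_comm _ _

theorem tensorLift_tmul_one {K : Type u} [Field K] [Algebra k K] (f : F →ₐ[k] K) (g : L →ₐ[k] K)
    (x : F) : tensorLift f g (x ⊗ₜ 1) = f x :=
  (Algebra.TensorProduct.lift_tmul _ _ _ _ _).trans (by rw [map_one, mul_one])

theorem tensorLift_one_tmul {K : Type u} [Field K] [Algebra k K] (f : F →ₐ[k] K) (g : L →ₐ[k] K)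
    (x : L) : tensorLift f g (1 ⊗ₜ x) = g x :=
  (Algebra.TensorProduct.lift_tmul _ _ _ _ _).trans (by rw [map_one, one_mul])

/-- The factor of `F ⊗_k L` through which a homomorphism to a field factors. -/
def kerFactor {K : Type u} [Field K] [Algebra k K] (f : (F ⊗[k] L) →ₐ[k] K) : FactorIndex F L :=
  ⟨RingHom.ker f, by
    have : IsArtinianRing (F ⊗[k] L) := IsArtinianRing.of_finite k (F ⊗[k] L)
    have : (RingHom.ker f).IsPrime := RingHom.ker_isPrime _
    exact IsArtinianRing.isMaximal_of_isPrime _⟩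

theorem mem_kerFactor {K : Type u} [Field K] [Algebra k K] (f : (F ⊗[k] L) →ₐ[k] K)
    (t : F ⊗[k] L) : t ∈ (kerFactor f).asIdeal ↔ f t = 0 :=
  RingHom.mem_ker

/-- Homomorphisms of fields are injective, so composing with `f` does not change the kernel.
Equality of two factors is always obtained in this way. -/
theorem kerFactor_comp_factorMk (j : FactorIndex F L) {K : Type u} [Field K] [Algebra k K]
    (f : factor j →ₐ[k] K) : kerFactor (f.comp (factorMk j)) = j := by
  ext t
  rw [mem_kerFactor, ← factorMk_eq_zero_iff]
  exact map_eq_zero_iff f f.injective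

/-- The homomorphism `E ⊗_k L → F ⊗_k L` attached to `E → F`. -/
abbrev baseChangeHom (L : FinExt k) (φ : E →ₐ[k] F) : (E ⊗[k] L) →ₐ[k] (F ⊗[k] L) :=
  Algebra.TensorProduct.map φ (AlgHom.id k L)

/-- The factor of `E ⊗_k L` below a factor of `F ⊗_k L`. -/
def factorBelow (φ : E →ₐ[k] F) (l : FactorIndex F L) : FactorIndex E L :=
  kerFactor ((factorMk l).comp (baseChangeHom L φ))

/-- The extension of factors attached to an extension `E → F`. -/
def factorMap (φ : E →ₐ[k] F) (j : FactorIndex E L) (l : FactorIndex F L)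
    (h : factorBelow φ l = j) : factor j →ₐ[k] factor l :=
  factorLift j ((factorMk l).comp (baseChangeHom L φ)) fun t ht ↦ by
    rwa [← h, factorBelow, mem_kerFactor] at ht

theorem factorMap_comp_left (φ : E →ₐ[k] F) (j : FactorIndex E L) (l : FactorIndex F L)
    (h : factorBelow φ l = j) :
    (factorMap φ j l h).comp (factorLeft j) = (factorLeft l).comp φ := by
  ext x
  change factorMk l (baseChangeHom L φ (x ⊗ₜ 1)) = factorMk l (φ x ⊗ₜ 1)
  simp

theorem factorMap_comp_right (φ : E →ₐ[k] F) (j : FactorIndex E L) (l : FactorIndex F L)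
    (h : factorBelow φ l = j) :
    (factorMap φ j l h).comp (factorRight j) = factorRight l := by
  ext x
  change factorMk l (baseChangeHom L φ (1 ⊗ₜ x)) = factorMk l (1 ⊗ₜ x)
  simp

instance (φ : E →ₐ[k] F) (j : FactorIndex E L) :
    Fintype {l : FactorIndex F L // factorBelow φ l = j} :=
  Fintype.ofFinite _

open AbelianVariety in
/-- Base change for the norm. -/
theorem res_factorLeft_norm [PerfectField k] {A : AbelianVariety k} (φ : E →ₐ[k] F)
    (j : FactorIndex E L) (x : A.Point F) :
    res (factorLeft j) (norm φ x) =
      ∑ l : {l : FactorIndex F L // factorBelow φ l = j},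
        norm (factorMap φ j l.1 l.2) (res (factorLeft l.1) x) := by
  let ω := IsScalarTower.toAlgHom k (factor j) (AlgebraicClosure (factor j))
  apply res_injective ω
  rw [← res_comp, res_norm_eq_sum, map_sum]
  simp_rw [res_norm_eq_sum]
  rw [Finset.sum_sigma', Finset.univ_sigma_univ]
  symm
  -- A pair of a factor `F_l` above `E_j` and an embedding of `F_l` over `E_j` corresponds to its
  -- restriction to `F`.
  refine Finset.sum_bij (fun p _ ↦ ⟨p.2.1.comp (factorLeft p.1.1), ?_⟩)
    (fun _ _ ↦ Finset.mem_univ _) ?_ ?_ fun p _ ↦ (res_comp _ _ _).symm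
  · rw [AlgHom.comp_assoc, ← factorMap_comp_left φ j p.1.1 p.1.2, ← AlgHom.comp_assoc, p.2.2]
  · rintro ⟨⟨l, hl⟩, τ, hτ⟩ - ⟨⟨l', hl'⟩, τ', hτ'⟩ - h
    have h₁ : τ.comp (factorLeft l) = τ'.comp (factorLeft l') := congrArg Subtype.val h
    -- On `L` both embeddings are given by `ω`. They therefore agree on all of `F ⊗ L`, and the
    -- common kernel determines the factor.
    have h₂ : τ.comp (factorRight l) = τ'.comp (factorRight l') := by
      rw [← factorMap_comp_right φ j l hl, ← AlgHom.comp_assoc, hτ,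
        ← factorMap_comp_right φ j l' hl', ← AlgHom.comp_assoc, hτ']
    have h₃ : τ.comp (factorMk l) = τ'.comp (factorMk l') := Algebra.TensorProduct.ext h₁ h₂
    obtain rfl : l = l' := by
      rw [← kerFactor_comp_factorMk l τ, h₃, kerFactor_comp_factorMk]
    obtain rfl := factor_hom_ext h₁ h₂
    rfl
  · rintro ⟨σ, hσ⟩ -
    -- Conversely, `σ` on `F` and `ω` on `L` define a map on `F ⊗ L`, and its kernel is the required
    -- factor.
    let f : (F ⊗[k] L) →ₐ[k] AlgebraicClosure (factor j) :=
      tensorLift σ (ω.comp (factorRight j))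
    have hf₁ (x : F) : f (x ⊗ₜ 1) = σ x := tensorLift_tmul_one _ _ x
    have hf₂ (x : L) : f (1 ⊗ₜ x) = ω (factorRight j x) := tensorLift_one_tmul _ _ x
    have hf : f.comp (baseChangeHom L φ) = ω.comp (factorMk j) := by
      refine Algebra.TensorProduct.ext (Eq.trans (AlgHom.ext fun x ↦ ?_) hσ)
        (AlgHom.ext fun x ↦ ?_)
      · change f (Algebra.TensorProduct.map φ (AlgHom.id k L) (x ⊗ₜ 1)) = σ (φ x)
        rw [Algebra.TensorProduct.map_tmul, AlgHom.id_apply, hf₁]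
      · change f (Algebra.TensorProduct.map φ (AlgHom.id k L) (1 ⊗ₜ x)) = ω (factorRight j x)
        rw [Algebra.TensorProduct.map_tmul, AlgHom.id_apply, map_one, hf₂]
    let τ : factor (kerFactor f) →ₐ[k] AlgebraicClosure (factor j) :=
      factorLift _ f fun t ht ↦ (mem_kerFactor f t).mp ht
    have hl : factorBelow φ (kerFactor f) = j := by
      refine Eq.trans ?_ ((congrArg kerFactor hf).trans (kerFactor_comp_factorMk j ω))
      ext t
      rw [factorBelow, mem_kerFactor, mem_kerFactor, ← map_eq_zero_iff τ τ.injective]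
      rfl
    refine ⟨⟨⟨kerFactor f, hl⟩, ⟨τ, ?_⟩⟩, Finset.mem_univ _, Subtype.ext (AlgHom.ext hf₁)⟩
    ext x
    obtain ⟨t, rfl⟩ := factorMk_surjective j x
    exact DFunLike.congr_fun hf t

end Factors

/-! ### Updating one entry of a concatenated family. -/

theorem addCases_update_left {n m : ℕ} {β : Fin (n + m) → Type u}
    (a : ∀ i, β (Fin.castAdd m i)) (b : ∀ i, β (Fin.natAdd n i)) (i : Fin n)
    (x : β (Fin.castAdd m i)) :
    (Fin.addCases (motive := β) (Function.update a i x) b : ∀ i, β i) =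
      Function.update (Fin.addCases (motive := β) a b) (Fin.castAdd m i) x := by
  ext l
  refine Fin.addCases (fun l ↦ ?_) (fun l ↦ ?_) l
  · by_cases h : l = i
    · subst h; simp
    · rw [Function.update_of_ne (by simpa using h)]
      simp [h]
  · rw [Function.update_of_ne (by simp [Fin.ext_iff]; omega)]
    simp

theorem addCases_update_right {n m : ℕ} {β : Fin (n + m) → Type u}
    (a : ∀ i, β (Fin.castAdd m i)) (b : ∀ i, β (Fin.natAdd n i)) (i : Fin m)
    (x : β (Fin.natAdd n i)) :
    (Fin.addCases (motive := β) a (Function.update b i x) : ∀ i, β i) =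
      Function.update (Fin.addCases (motive := β) a b) (Fin.natAdd n i) x := by
  ext l
  refine Fin.addCases (fun l ↦ ?_) (fun l ↦ ?_) l
  · rw [Function.update_of_ne (by simp [Fin.ext_iff]; omega)]
    simp
  · by_cases h : l = i
    · subst h; simp
    · rw [Function.update_of_ne (by simpa using h)]
      simp [h]

theorem apply_addCases {n m : ℕ} {β γ : Fin (n + m) → Type u} (f : ∀ i, β i → γ i)
    (a : ∀ i, β (Fin.castAdd m i)) (b : ∀ i, β (Fin.natAdd n i)) :
    (fun l ↦ f l (Fin.addCases (motive := β) a b l)) =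
      Fin.addCases (motive := γ) (fun i ↦ f _ (a i)) (fun i ↦ f _ (b i)) := by
  ext l
  refine Fin.addCases (fun l ↦ ?_) (fun l ↦ ?_) l <;> simp

/-! ### Symbols, and homomorphisms out of the `K`-group. -/

section TensorSum

variable {k : Type u} [Field k] {I : Type} (A : I → AbelianVariety k)

/-- The homomorphism on the direct sum given by multilinear maps on the summands. -/
def tensorSumLift {M : Type*} [AddCommGroup M]
    (f : ∀ F : FinExt k, MultilinearMap ℤ (fun i ↦ (A i).Point F) M) : TensorSum A →+ M :=
  letI := Classical.decEq (FinExt k)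
  DirectSum.toAddMonoid fun F ↦ (PiTensorProduct.lift (f F)).toAddMonoidHom

theorem tensorSumLift_pureTensor {M : Type*} [AddCommGroup M]
    (f : ∀ F : FinExt k, MultilinearMap ℤ (fun i ↦ (A i).Point F) M) (F : FinExt k)
    (a : ∀ i, (A i).Point F) : tensorSumLift A f (pureTensor A F a) = f F a := by
  let _ := Classical.decEq (FinExt k)
  exact (DirectSum.toAddMonoid_of _ _ _).trans (PiTensorProduct.lift.tprod a)

end TensorSum

section Symbol

variable {k : Type u} [Field k] [PerfectField k] {I : Type} [DecidableEq I]
  (A : I → AbelianVariety k)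

/-- The symbol as a multilinear map. -/
def symbolMap (F : FinExt k) : MultilinearMap ℤ (fun i ↦ (A i).Point F) (KGroup A) :=
  letI := Classical.decEq (FinExt k)
  (((QuotientAddGroup.mk' (weilReciprocity A)).comp
    ((QuotientAddGroup.mk' (projectionFormula A)).comp
      (DirectSum.of (fun F : FinExt k ↦ ⨂[ℤ] i, (A i).Point F) F))).toIntLinearMap).compMultilinearMap
    (PiTensorProduct.tprod ℤ)

theorem symbol_update_add (F : FinExt k) (a : ∀ i, (A i).Point F) (i : I) (x y : (A i).Point F) :
    symbol A F (Function.update a i (x + y)) =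
      symbol A F (Function.update a i x) + symbol A F (Function.update a i y) :=
  (symbolMap A F).map_update_add a i x y

theorem symbol_update_zsmul (F : FinExt k) (a : ∀ i, (A i).Point F) (i : I) (n : ℤ)
    (x : (A i).Point F) :
    symbol A F (Function.update a i (n • x)) = n • symbol A F (Function.update a i x) :=
  (symbolMap A F).map_update_smul a i n x

theorem symbol_update_sum (F : FinExt k) (a : ∀ i, (A i).Point F) (i : I) {ι : Type*}
    (s : Finset ι) (x : ι → (A i).Point F) :
    symbol A F (Function.update a i (∑ l ∈ s, x l)) =
      ∑ l ∈ s, symbol A F (Function.update a i (x l)) :=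
  (symbolMap A F).map_update_sum s i x a

/-- The projection formula. -/
theorem symbol_update_norm {E F : FinExt k} (φ : E →ₐ[k] F) (i : I) (x : (A i).Point F)
    (a : ∀ j, (A j).Point E) :
    symbol A E (Function.update a i (AbelianVariety.norm φ x)) =
      symbol A F (Function.update (fun j ↦ AbelianVariety.res φ (a j)) i x) := by
  refine congrArg (QuotientAddGroup.mk (s := weilReciprocity A)) (QuotientAddGroup.eq_iff_sub_mem.mpr ?_)
  exact AddSubgroup.subset_closure ⟨E, F, φ, i, x, a, rfl⟩

/-- Symbols only depend on the isomorphism class of the extension. -/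
theorem symbol_res_algEquiv [Nonempty I] {E F : FinExt k} (e : E ≃ₐ[k] F)
    (a : ∀ i, (A i).Point E) :
    symbol A F (fun i ↦ AbelianVariety.res e.toAlgHom (a i)) = symbol A E a := by
  let i : I := Classical.arbitrary I
  -- This is the projection formula at an arbitrary place `i`, for the point `res a_i`, whose norm
  -- is `a_i`.
  have h := symbol_update_norm A e.toAlgHom i (AbelianVariety.res e.toAlgHom (a i)) a
  rw [AbelianVariety.norm_res_algEquiv, Function.update_eq_self] at h
  rw [h]
  congr 1
  exact (Function.update_eq_self i (fun j ↦ AbelianVariety.res e.toAlgHom (a j))).symm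

-- The `K`-group is a quotient of a direct sum of tensor products, so it is generated by symbols.
variable {A} in
theorem KGroup.hom_ext {M : Type*} [AddCommGroup M] {f g : KGroup A →+ M}
    (h : ∀ (F : FinExt k) (a : ∀ i, (A i).Point F), f (symbol A F a) = g (symbol A F a)) :
    f = g := by
  let _ := Classical.decEq (FinExt k)
  refine QuotientAddGroup.addMonoidHom_ext _ (QuotientAddGroup.addMonoidHom_ext _
    (DirectSum.addHom_ext' fun F ↦ ?_))
  have h' : (((f.comp (QuotientAddGroup.mk' _)).comp (QuotientAddGroup.mk' _)).comp
      (DirectSum.of (fun F : FinExt k ↦ ⨂[ℤ] i, (A i).Point F) F)).toIntLinearMap =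
      (((g.comp (QuotientAddGroup.mk' _)).comp (QuotientAddGroup.mk' _)).comp
      (DirectSum.of (fun F : FinExt k ↦ ⨂[ℤ] i, (A i).Point F) F)).toIntLinearMap :=
    PiTensorProduct.ext (MultilinearMap.ext fun a ↦ h F a)
  exact AddMonoidHom.ext fun x ↦ DFunLike.congr_fun h' x

/-- Multilinear maps on points that satisfy the projection formula and Weil reciprocity come from
a homomorphism on the `K`-group. -/
theorem KGroup.exists_lift {M : Type*} [AddCommGroup M]
    (f : ∀ F : FinExt k, MultilinearMap ℤ (fun i ↦ (A i).Point F) M)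
    (hp : ∀ (E F : FinExt k) (φ : E →ₐ[k] F) (i : I) (x : (A i).Point F) (a : ∀ j, (A j).Point E),
      f E (Function.update a i (AbelianVariety.norm φ x)) =
        f F (Function.update (fun j ↦ AbelianVariety.res φ (a j)) i x))
    (hw : ∀ (C : Over (Spec (.of k))) (_ : IsSmoothProjectiveCurve C)
      (g : ∀ i, C ⟶ (A i).scheme) (t : C.left.functionField) (S : Finset (ClosedPoint C)),
      t ≠ 0 → (∀ x : ClosedPoint C, Scheme.ord t x.1 ≠ 0 → x ∈ S) →
      ∑ x ∈ S, Scheme.ord t x.1 • f (residueExt x) (fun i ↦ .ofHom (inclusion x ≫ g i)) = 0) :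
    ∃ Φ : KGroup A →+ M, ∀ (F : FinExt k) (a : ∀ i, (A i).Point F), Φ (symbol A F a) = f F a := by
  let Φ₁ : MackeyProduct A →+ M := QuotientAddGroup.lift _ (tensorSumLift A f) (by
    rw [projectionFormula, AddSubgroup.closure_le]
    rintro _ ⟨E, F, φ, i, x, a, rfl⟩
    rw [SetLike.mem_coe, AddMonoidHom.mem_ker, map_sub, tensorSumLift_pureTensor,
      tensorSumLift_pureTensor, hp, sub_self])
  have h₁ (F : FinExt k) (a : ∀ i, (A i).Point F) : Φ₁ (mackeySymbol A F a) = f F a :=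
    tensorSumLift_pureTensor A f F a
  let Φ₂ : KGroup A →+ M := QuotientAddGroup.lift _ Φ₁ (by
    rw [weilReciprocity, AddSubgroup.closure_le]
    rintro _ ⟨C, hC, g, t, S, ht, hS, rfl⟩
    rw [SetLike.mem_coe, AddMonoidHom.mem_ker, map_sum, ← hw C hC g t S ht hS]
    exact Finset.sum_congr rfl fun x _ ↦ by rw [map_zsmul, h₁])
  exact ⟨Φ₂, h₁⟩

end Symbol

/-! ### The sum over the factors, and the projection formula. -/

section Pairing

variable {k : Type u} [Field k] {n m : ℕ} (A : Fin (n + m) → AbelianVariety k)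
  (L : FinExt k)

/-- The points `res a_1, …, res a_n, res b_1, …, res b_m` over the factor `L_j`. -/
def factorPoints {F : FinExt k} (j : FactorIndex F L) (a : ∀ i, (A (Fin.castAdd m i)).Point F)
    (b : ∀ i, (A (Fin.natAdd n i)).Point L) (i : Fin (n + m)) : (A i).Point (factor j) :=
  Fin.addCases (motive := fun i ↦ (A i).Point (factor j))
    (fun i ↦ AbelianVariety.res (factorLeft j) (a i))
    (fun i ↦ AbelianVariety.res (factorRight j) (b i)) i

variable {A L}

theorem factorPoints_update_left {F : FinExt k} (j : FactorIndex F L)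
    (a : ∀ i, (A (Fin.castAdd m i)).Point F) (b : ∀ i, (A (Fin.natAdd n i)).Point L) (i : Fin n)
    (x : (A (Fin.castAdd m i)).Point F) :
    factorPoints A L j (Function.update a i x) b =
      Function.update (factorPoints A L j a b) (Fin.castAdd m i)
        (AbelianVariety.res (factorLeft j) x) := by
  refine Eq.trans ?_ (addCases_update_left (β := fun i ↦ (A i).Point (factor j)) _ _ i _)
  exact congrArg (fun c ↦ (Fin.addCases (motive := fun i ↦ (A i).Point (factor j)) c
    (fun i ↦ AbelianVariety.res (factorRight j) (b i)) :
    ∀ i, (A i).Point (factor j)))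
    (funext fun l ↦ Function.apply_update (fun _ ↦ AbelianVariety.res (factorLeft j)) a i x l)

theorem factorPoints_update_right {F : FinExt k} (j : FactorIndex F L)
    (a : ∀ i, (A (Fin.castAdd m i)).Point F) (b : ∀ i, (A (Fin.natAdd n i)).Point L) (i : Fin m)
    (x : (A (Fin.natAdd n i)).Point L) :
    factorPoints A L j a (Function.update b i x) =
      Function.update (factorPoints A L j a b) (Fin.natAdd n i)
        (AbelianVariety.res (factorRight j) x) := by
  refine Eq.trans ?_ (addCases_update_right (β := fun i ↦ (A i).Point (factor j)) _ _ i _)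
  exact congrArg (fun c ↦ (Fin.addCases (motive := fun i ↦ (A i).Point (factor j))
    (fun i ↦ AbelianVariety.res (factorLeft j) (a i)) c :
    ∀ i, (A i).Point (factor j)))
    (funext fun l ↦ Function.apply_update (fun _ ↦ AbelianVariety.res (factorRight j)) b i x l)

theorem res_factorMap_factorPoints {E F : FinExt k} (φ : E →ₐ[k] F) (j : FactorIndex E L)
    (l : FactorIndex F L) (h : factorBelow φ l = j) (a : ∀ i, (A (Fin.castAdd m i)).Point E)
    (b : ∀ i, (A (Fin.natAdd n i)).Point L) :
    (fun i ↦ AbelianVariety.res (factorMap φ j l h) (factorPoints A L j a b i)) =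
      factorPoints A L l (fun i ↦ AbelianVariety.res φ (a i)) b := by
  refine (apply_addCases (β := fun i ↦ (A i).Point (factor j))
    (fun _ ↦ AbelianVariety.res (factorMap φ j l h)) _ _).trans ?_
  unfold factorPoints
  simp_rw [← AbelianVariety.res_comp, factorMap_comp_left, factorMap_comp_right]

variable (A L) [PerfectField k]

/-- The sum of the symbols over the factors of `F ⊗_k L`, as a multilinear map. -/
def factorSum (F : FinExt k) : MultilinearMap ℤ (fun i ↦ (A (Fin.castAdd m i)).Point F)
    (MultilinearMap ℤ (fun i ↦ (A (Fin.natAdd n i)).Point L) (KGroup A)) where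
  toFun a :=
    { toFun b := ∑ j : FactorIndex F L, symbol A (factor j) (factorPoints A L j a b)
      map_update_add' b i x y := by
        -- `MultilinearMap` quantifies over all decidability instances, while the update lemmas use
        -- the canonical one.
        obtain rfl := Subsingleton.elim ‹DecidableEq (Fin m)› (instDecidableEqFin m)
        rw [← Finset.sum_add_distrib]
        exact Finset.sum_congr rfl fun j _ ↦ by
          simp_rw [factorPoints_update_right, map_add, symbol_update_add]
      map_update_smul' b i c x := by
        obtain rfl := Subsingleton.elim ‹DecidableEq (Fin m)› (instDecidableEqFin m)
        rw [Finset.smul_sum]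
        exact Finset.sum_congr rfl fun j _ ↦ by
          simp_rw [factorPoints_update_right, map_zsmul, symbol_update_zsmul] }
  map_update_add' a i x y := by
    obtain rfl := Subsingleton.elim ‹DecidableEq (Fin n)› (instDecidableEqFin n)
    ext b
    refine Eq.trans ?_ Finset.sum_add_distrib
    exact Finset.sum_congr rfl fun j _ ↦ by
      simp_rw [factorPoints_update_left, map_add, symbol_update_add]
  map_update_smul' a i c x := by
    obtain rfl := Subsingleton.elim ‹DecidableEq (Fin n)› (instDecidableEqFin n)
    ext b
    refine Eq.trans ?_ Finset.smul_sum.symm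
    exact Finset.sum_congr rfl fun j _ ↦ by
      simp_rw [factorPoints_update_left, map_zsmul, symbol_update_zsmul]

theorem factorSum_apply (F : FinExt k) (a : ∀ i, (A (Fin.castAdd m i)).Point F)
    (b : ∀ i, (A (Fin.natAdd n i)).Point L) :
    factorSum A L F a b = ∑ j : FactorIndex F L, symbol A (factor j) (factorPoints A L j a b) :=
  rfl

/-- Over each factor `E_j` the entry `N(x)` becomes a sum of norms from the factors `F_l` above
`E_j`, and the projection formula for `F_l / E_j` moves each term up to `F_l`. Summing over `j` and
then over the fibre above `j` is summing over all `l`. -/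
theorem factorSum_update_norm {E F : FinExt k} (φ : E →ₐ[k] F) (i : Fin n)
    (x : (A (Fin.castAdd m i)).Point F) (a : ∀ j, (A (Fin.castAdd m j)).Point E) :
    factorSum A L E (Function.update a i (AbelianVariety.norm φ x)) =
      factorSum A L F (Function.update (fun j ↦ AbelianVariety.res φ (a j)) i x) := by
  ext b
  rw [factorSum_apply, factorSum_apply]
  simp_rw [factorPoints_update_left, res_factorLeft_norm, symbol_update_sum, symbol_update_norm,
    res_factorMap_factorPoints]
  rw [Finset.sum_sigma', Finset.univ_sigma_univ]
  exact Fintype.sum_equiv (Equiv.sigmaFiberEquiv (factorBelow φ)) _ _ fun _ ↦ rfl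

end Pairing

/-! ### Local rings with principal maximal ideal. -/

section LocalRing

open IsLocalRing

/-- A noetherian local ring whose maximal ideal is generated by a nonzerodivisor is a domain. -/
theorem isDomain_of_maximalIdeal_eq_span {R : Type*} [CommRing R] [IsLocalRing R]
    [IsNoetherianRing R] {π : R} (hπ : maximalIdeal R = Ideal.span {π})
    (h : ∀ r : R, π * r = 0 → r = 0) : IsDomain R := by
  have hpow (n : ℕ) : ∀ r : R, π ^ n * r = 0 → r = 0 := by
    induction n with
    | zero => simp
    | succ n ih => exact fun r hr ↦ h r (ih _ (by rw [← mul_assoc, ← pow_succ, hr]))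
  -- By Krull's intersection theorem there is a largest `n` with `a` in the `n`-th power of the
  -- maximal ideal; the cofactor of `π ^ n` is then a unit.
  have hdec (a : R) (ha : a ≠ 0) : ∃ (n : ℕ) (u : Rˣ), a = π ^ n * u := by
    have h₁ : ∃ n, a ∉ maximalIdeal R ^ n := by
      by_contra! hall
      exact ha ((Submodule.mem_bot R).mp
        (Ideal.iInf_pow_eq_bot_of_isLocalRing _ (maximalIdeal.isMaximal R).ne_top ▸
          (Submodule.mem_iInf _).mpr hall))
    classical
    obtain ⟨n, hn⟩ : ∃ n, Nat.find h₁ = n + 1 := by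
      refine Nat.exists_eq_succ_of_ne_zero fun h0 ↦ Nat.find_spec h₁ ?_
      rw [h0, pow_zero, Ideal.one_eq_top]
      trivial
    have h₂ : a ∈ maximalIdeal R ^ n := not_not.mp (Nat.find_min h₁ (by omega))
    have h₃ : a ∉ maximalIdeal R ^ (n + 1) := hn ▸ Nat.find_spec h₁
    rw [hπ, Ideal.span_singleton_pow, Ideal.mem_span_singleton] at h₂ h₃
    obtain ⟨c, rfl⟩ := h₂
    have hc : IsUnit c := by
      by_contra hc
      have hc' : c ∈ Ideal.span {π} := hπ ▸ (mem_maximalIdeal c).mpr hc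
      obtain ⟨d, rfl⟩ := Ideal.mem_span_singleton.mp hc'
      exact h₃ ⟨d, by ring⟩
    exact ⟨n, hc.unit, rfl⟩
  have : NoZeroDivisors R := ⟨fun {a b} hab ↦ by
    by_contra! hne
    obtain ⟨n, u, rfl⟩ := hdec a hne.1
    exact hne.2 ((Units.mul_right_eq_zero u).mp (hpow n _ (by rw [← mul_assoc, hab])))⟩
  exact NoZeroDivisors.to_isDomain R

variable {R S : Type*} [CommRing R] [IsLocalRing R] [CommRing S] [IsLocalRing S] [Algebra R S]

/-- A nonzero generator `π` is a nonzerodivisor in `R`, remains one in `S` by flatness, and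
generates the maximal ideal of `S`. If `π = 0`, then `S` is a field. -/
theorem isDomain_of_flat_of_map_maximalIdeal [IsDomain R] [IsNoetherianRing S] [Module.Flat R S]
    (hR : (maximalIdeal R).IsPrincipal)
    (h : (maximalIdeal R).map (algebraMap R S) = maximalIdeal S) : IsDomain S := by
  obtain ⟨π, hπ⟩ := hR
  rw [Ideal.submodule_span_eq] at hπ
  rw [hπ, Ideal.map_span, Set.image_singleton] at h
  by_cases h0 : π = 0
  · have : maximalIdeal S = ⊥ := by rw [← h, h0, map_zero, Ideal.span_singleton_eq_bot]
    exact (isField_iff_maximalIdeal_eq.mpr this).isDomain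
  · refine isDomain_of_maximalIdeal_eq_span h.symm fun s hs ↦ ?_
    rw [← Algebra.smul_def] at hs
    exact (smul_eq_zero.mp hs).resolve_left h0

theorem isPrincipal_of_map_maximalIdeal (hR : (maximalIdeal R).IsPrincipal)
    (h : (maximalIdeal R).map (algebraMap R S) = maximalIdeal S) :
    (maximalIdeal S).IsPrincipal := by
  obtain ⟨π, hπ⟩ := hR
  rw [Ideal.submodule_span_eq] at hπ
  exact ⟨algebraMap R S π, by rw [← h, hπ, Ideal.map_span, Set.image_singleton]⟩

theorem isField_iff_of_map_maximalIdeal (hinj : Function.Injective (algebraMap R S))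
    (h : (maximalIdeal R).map (algebraMap R S) = maximalIdeal S) : IsField R ↔ IsField S := by
  rw [isField_iff_maximalIdeal_eq, isField_iff_maximalIdeal_eq, ← h,
    Ideal.map_eq_bot_iff_of_injective hinj]

theorem isDiscreteValuationRing_of_isPrincipal [IsDomain R] [IsNoetherianRing R]
    (hR : (maximalIdeal R).IsPrincipal) (h : ¬ IsField R) : IsDiscreteValuationRing R :=
  ((IsDiscreteValuationRing.TFAE R h).out 0 4).mpr hR

/-- The ramification index is one: a uniformizer of `R` is sent to a uniformizer of `S`, so
factorizations into a unit and a power of it carry over. -/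
theorem ordFrac_map_eq {R S : Type*} [CommRing R] [IsDomain R] [CommRing S] [Algebra R S]
    [IsDiscreteValuationRing R] [IsDomain S] [IsDiscreteValuationRing S]
    {K K' : Type*} [Field K] [Algebra R K] [IsFractionRing R K] [Field K'] [Algebra S K']
    [IsFractionRing S K'] (h : (maximalIdeal R).map (algebraMap R S) = maximalIdeal S)
    (φ : K →+* K') (hφ : ∀ r : R, φ (algebraMap R K r) = algebraMap S K' (algebraMap R S r))
    (x : K) : Ring.ordFrac S (φ x) = Ring.ordFrac R x := by
  obtain ⟨π, hπ⟩ := IsDiscreteValuationRing.exists_irreducible R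
  have hπ' : Irreducible (algebraMap R S π) := by
    rw [IsDiscreteValuationRing.irreducible_iff_uniformizer] at hπ ⊢
    rw [← h, hπ, Ideal.map_span, Set.image_singleton]
  have key (r : R) : Ring.ordFrac S (φ (algebraMap R K r)) = Ring.ordFrac R (algebraMap R K r) := by
    by_cases hr : r = 0
    · simp [hr]
    obtain ⟨n, u, rfl⟩ := IsDiscreteValuationRing.eq_unit_mul_pow_irreducible hr hπ
    have hu : Ring.ordFrac R (algebraMap R K u) = 1 :=
      Ring.isUnit_iff_ordFrac_one_of_isDiscreteValuationRing.mp u.isUnit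
    have hu' : Ring.ordFrac S (algebraMap S K' (algebraMap R S u)) = 1 :=
      Ring.isUnit_iff_ordFrac_one_of_isDiscreteValuationRing.mp (u.isUnit.map _)
    simp only [map_mul, map_pow, hφ, hu, hu', Ring.ordFrac_irreducible hπ,
      Ring.ordFrac_irreducible hπ']
  obtain ⟨a, b, hb, rfl⟩ := IsFractionRing.div_surjective (A := R) x
  rw [map_div₀, map_div₀, map_div₀, key, key]

theorem isPrincipalIdealRing_of_isLocalization {R : Type*} (S : Type*) [CommRing R]
    [IsPrincipalIdealRing R] (M : Submonoid R) [CommRing S] [Algebra R S] [IsLocalization M S] :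
    IsPrincipalIdealRing S where
  principal I := by
    obtain ⟨a, ha⟩ := IsPrincipalIdealRing.principal (I.under R)
    refine ⟨algebraMap R S a, ?_⟩
    rw [← IsLocalization.map_under M S I, ha, Ideal.submodule_span_eq, Ideal.submodule_span_eq,
      Ideal.map_span, Set.image_singleton]

end LocalRing

/-! ### Stalks under étale morphisms and on smooth curves. -/

section Stalk

open IsLocalRing

variable {X Y : Scheme.{u}} (f : X ⟶ Y)

/-- An étale morphism is unramified, and for an unramified local homomorphism essentially of finite
type the maximal ideal downstairs generates the one upstairs. -/
theorem map_maximalIdeal_stalkMap [Etale f] (x : X) :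
    (maximalIdeal (Y.presheaf.stalk (f x))).map (f.stalkMap x).hom =
      maximalIdeal (X.presheaf.stalk x) := by
  algebraize [(f.stalkMap x).hom]
  have : IsLocalHom (algebraMap (Y.presheaf.stalk (f x)) (X.presheaf.stalk x)) :=
    inferInstanceAs <| IsLocalHom (f.stalkMap x).hom
  have : Algebra.EssFiniteType (Y.presheaf.stalk (f x)) (X.presheaf.stalk x) := by
    rw [← RingHom.essFiniteType_algebraMap, RingHom.algebraMap_toAlgebra]
    exact LocallyOfFiniteType.stalkMap f x
  have : Algebra.FormallyUnramified (Y.presheaf.stalk (f x)) (X.presheaf.stalk x) :=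
    FormallyUnramified.stalkMap f x
  exact Algebra.FormallyUnramified.map_maximalIdeal

theorem isPrincipal_maximalIdeal_stalk [Etale f] (x : X)
    (h : (maximalIdeal (Y.presheaf.stalk (f x))).IsPrincipal) :
    (maximalIdeal (X.presheaf.stalk x)).IsPrincipal := by
  algebraize [(f.stalkMap x).hom]
  exact isPrincipal_of_map_maximalIdeal h (map_maximalIdeal_stalkMap f x)

theorem isDomain_stalk [Etale f] [IsLocallyNoetherian X] (x : X)
    [IsDomain (Y.presheaf.stalk (f x))]
    (h : (maximalIdeal (Y.presheaf.stalk (f x))).IsPrincipal) :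
    IsDomain (X.presheaf.stalk x) := by
  have hflat := Flat.stalkMap f x
  algebraize [(f.stalkMap x).hom]
  exact isDomain_of_flat_of_map_maximalIdeal h (map_maximalIdeal_stalkMap f x)

end Stalk

section Curve

open IsLocalRing

variable {k : Type u} [Field k]

theorem isPrincipalIdealRing_mvPolynomial_fin_one {R : Type u} [CommRing R] (hR : IsField R) :
    IsPrincipalIdealRing (MvPolynomial (Fin 1) R) := by
  let _ := hR.toField
  let e := (MvPolynomial.uniqueAlgEquiv R (Fin 1)).symm
  exact IsPrincipalIdealRing.of_surjective e.toRingEquiv.toRingHom e.surjective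

theorem isPrincipalIdealRing_stalk_spec (R : CommRingCat.{u}) [IsPrincipalIdealRing R]
    (p : Spec R) : IsPrincipalIdealRing ((Spec R).presheaf.stalk p) := by
  let _ : Algebra R ((Spec R).presheaf.stalk p) := StructureSheaf.stalkAlgebra R p
  have : p.asIdeal.IsPrime := p.2
  have : IsLocalization.AtPrime ((Spec R).presheaf.stalk p) p.asIdeal :=
    StructureSheaf.IsLocalization.to_stalk R p
  exact isPrincipalIdealRing_of_isLocalization _ p.asIdeal.primeCompl

/-- The maximal ideals of the local rings of a smooth curve are principal. -/
theorem isPrincipal_maximalIdeal_stalk_curve (C : Over (Spec (.of k))) [IsSmoothProjectiveCurve C]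
    (x : C.left) : (maximalIdeal (C.left.presheaf.stalk x)).IsPrincipal := by
  -- Near `x` the curve is étale over an affine line, whose local rings are principal ideal rings.
  obtain ⟨U, hU, V, hV, hx, e, h⟩ :=
    SmoothOfRelativeDimension.exists_isStandardSmoothOfRelativeDimension (n := 1) (f := C.hom) x
  obtain ⟨g, -, hg⟩ := h.exists_etale_mvPolynomial
  have hUf : IsField Γ(Spec (.of k), U) := by
    -- `Spec k` has a single point, and `U` contains the image of `x`.
    obtain rfl : U = ⊤ := top_le_iff.mp fun y _ ↦ Subsingleton.elim (C.hom x) y ▸ e hx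
    exact isField_of_isIntegral_of_subsingleton _
  have hpir := isPrincipalIdealRing_mvPolynomial_fin_one hUf
  let q := Spec.map (CommRingCat.ofHom g)
  have : Etale q := by
    rw [HasRingHomProperty.Spec_iff (P := @Etale)]
    exact hg
  obtain ⟨y, rfl⟩ : ∃ y, hV.fromSpec y = x := by
    have : x ∈ Set.range hV.fromSpec := by rw [hV.range_fromSpec]; exact hx
    exact this
  have hq : (maximalIdeal ((Spec (.of (MvPolynomial (Fin 1) Γ(Spec (.of k), U)))).presheaf.stalk
      (q y))).IsPrincipal := by
    exact (isPrincipalIdealRing_stalk_spec _ _).principal _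
  let φ : (Spec Γ(C.left, V)).presheaf.stalk y ⟶ C.left.presheaf.stalk (hV.fromSpec y) :=
    inv (hV.fromSpec.stalkMap y)
  algebraize [φ.hom]
  have hφ : Function.Surjective φ.hom := (ConcreteCategory.bijective_of_isIso φ).2
  exact isPrincipal_of_map_maximalIdeal (isPrincipal_maximalIdeal_stalk q y hq)
    (map_maximalIdeal_of_surjective φ.hom hφ)

end Curve

/-! ### Function fields and orders of vanishing. -/

section FunctionField

open IsLocalRing TopologicalSpace

/-- Generalizations lift along flat morphisms, and the only generalization of the generic point of
`X` is itself. -/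
theorem map_genericPoint_of_flat {X Y : Scheme.{u}} [IsIntegral X] [IsIntegral Y] (f : X ⟶ Y)
    [Flat f] : f (genericPoint X) = genericPoint Y := by
  obtain ⟨x, hx, hxy⟩ := Flat.generalizingMap f
    ((genericPoint_spec Y).specializes (Set.mem_univ (f (genericPoint X))))
  rw [← hxy]
  exact congrArg f (((genericPoint_spec X).specializes (Set.mem_univ x)).antisymm hx).eq

/-- The homomorphism of function fields attached to a flat morphism. -/
def functionFieldMap {X Y : Scheme.{u}} [IsIntegral X] [IsIntegral Y] (f : X ⟶ Y) [Flat f] :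
    Y.functionField ⟶ X.functionField :=
  Y.presheaf.stalkSpecializes (specializes_of_eq (map_genericPoint_of_flat f)) ≫
    f.stalkMap (genericPoint X)

theorem functionFieldMap_algebraMap {X Y : Scheme.{u}} [IsIntegral X] [IsIntegral Y] (f : X ⟶ Y)
    [Flat f] (x : X) (r : Y.presheaf.stalk (f x)) :
    (functionFieldMap f).hom (algebraMap _ Y.functionField r) =
      algebraMap _ X.functionField ((f.stalkMap x).hom r) := by
  have h : Y.presheaf.stalkSpecializes
      ((genericPoint_spec Y).specializes (Set.mem_univ (f x))) ≫ functionFieldMap f =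
      f.stalkMap x ≫ X.presheaf.stalkSpecializes
        ((genericPoint_spec X).specializes (Set.mem_univ x)) := by
    rw [functionFieldMap]
    refine (Y.presheaf.stalkSpecializes_comp_assoc _ _ _).trans ?_
    exact f.stalkSpecializes_stalkMap _ _ _
  exact congrArg (fun φ ↦ φ.hom r) h

/-- Étale morphisms preserve orders of vanishing on regular curves. -/
theorem ord_functionFieldMap {X Y : Scheme.{u}} [IsIntegral X] [IsIntegral Y]
    [IsLocallyNoetherian X] [IsLocallyNoetherian Y] (f : X ⟶ Y) [Etale f] (x : X)
    (h : (maximalIdeal (Y.presheaf.stalk (f x))).IsPrincipal) (t : Y.functionField) :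
    Scheme.ord ((functionFieldMap f).hom t) x = Scheme.ord t (f x) := by
  have hmax := map_maximalIdeal_stalkMap f x
  have hpr := isPrincipal_maximalIdeal_stalk f x h
  have hflat := Flat.stalkMap f x
  have hcomm := functionFieldMap_algebraMap f x
  have hloc : IsLocalHom (f.stalkMap x).hom := inferInstance
  algebraize [(f.stalkMap x).hom]
  have : IsLocalHom (algebraMap (Y.presheaf.stalk (f x)) (X.presheaf.stalk x)) := hloc
  have hinj : Function.Injective (algebraMap (Y.presheaf.stalk (f x)) (X.presheaf.stalk x)) :=
    FaithfulSMul.algebraMap_injective _ _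
  -- If the stalks are fields, both points have coheight 0, and `Scheme.ord` vanishes by convention
  -- away from coheight 1.
  by_cases hF : IsField (Y.presheaf.stalk (f x))
  · have hF' := (isField_iff_of_map_maximalIdeal hinj hmax).mp hF
    rw [Scheme.ord_eq_zero_of_coheight_neq_one, Scheme.ord_eq_zero_of_coheight_neq_one]
    · intro h1
      have := ringKrullDim_stalk_eq_coheight (f x)
      rw [ringKrullDim_eq_zero_of_isField hF, h1] at this
      exact absurd this (by decide)
    · intro h1
      have := ringKrullDim_stalk_eq_coheight x
      rw [ringKrullDim_eq_zero_of_isField hF', h1] at this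
      exact absurd this (by decide)
  · have hF' := mt (isField_iff_of_map_maximalIdeal hinj hmax).mpr hF
    have := isDiscreteValuationRing_of_isPrincipal h hF
    have := isDiscreteValuationRing_of_isPrincipal hpr hF'
    have hy : Order.coheight (f x) = 1 := by
      have := ringKrullDim_stalk_eq_coheight (f x)
      rw [IsDiscreteValuationRing.ringKrullDim_eq_one] at this
      exact_mod_cast this.symm
    have hx : Order.coheight x = 1 := by
      have := ringKrullDim_stalk_eq_coheight x
      rw [IsDiscreteValuationRing.ringKrullDim_eq_one] at this
      exact_mod_cast this.symm
    rw [Scheme.ord_eq_ordHom_of_coheight_eq_one hx, Scheme.ord_eq_ordHom_of_coheight_eq_one hy]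
    have := ordFrac_map_eq hmax (functionFieldMap f).hom hcomm t
    -- `Scheme.ord` reads an integer off `Ring.ordFrac`; the default 1, additively 0, serves the
    -- zero function.
    exact congrArg (fun a : WithZero (Multiplicative ℤ) ↦ Multiplicative.toAdd (a.unzeroD 1)) this

end FunctionField

/-! ### Irreducible components when all stalks are domains. -/

section Components

variable {X : Scheme.{u}}

/-- The generic point of a component through `x` is a generalization of `x`, so it lies in the image
of the spectrum of the stalk. This image is irreducible, hence its closure is the only component
through `x`. -/
theorem eq_of_mem_irreducibleComponents {x : X} [IsDomain (X.presheaf.stalk x)] {Z Z' : Set X}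
    (hZ : Z ∈ irreducibleComponents X) (hZ' : Z' ∈ irreducibleComponents X) (hx : x ∈ Z)
    (hx' : x ∈ Z') : Z = Z' := by
  have hirr : IsIrreducible (Set.range (X.fromSpecStalk x)) := by
    rw [← Set.image_univ]
    exact IrreducibleSpace.isIrreducible_univ _ |>.image _ (X.fromSpecStalk x).continuous.continuousOn
  have key {W : Set X} (hW : W ∈ irreducibleComponents X) (hx : x ∈ W) :
      W = closure (Set.range (X.fromSpecStalk x)) := by
    obtain ⟨η, hη⟩ := QuasiSober.sober hW.1 (isClosed_of_mem_irreducibleComponents W hW)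
    have hle : W ⊆ closure (Set.range (X.fromSpecStalk x)) := by
      rw [← show closure {η} = W from hη]
      refine closure_mono (Set.singleton_subset_iff.mpr ?_)
      rw [Scheme.range_fromSpecStalk]
      exact hη.specializes hx
    exact hle.antisymm (hW.2 hirr.closure hle)
  rw [key hZ hx, key hZ' hx']

/-- Components are pairwise disjoint, so the complement of one is the finite union of the others,
which are closed. -/
theorem isOpen_of_mem_irreducibleComponents [IsNoetherian X]
    [∀ x : X, IsDomain (X.presheaf.stalk x)] {Z : Set X} (hZ : Z ∈ irreducibleComponents X) :
    IsOpen Z := by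
  have h : Z = (⋃₀ (irreducibleComponents X \ {Z}))ᶜ := by
    ext x
    refine ⟨fun hx ⟨W, hW, hxW⟩ ↦ hW.2 (eq_of_mem_irreducibleComponents hW.1 hZ hxW hx),
      fun hx ↦ by_contra fun hxZ ↦ hx ⟨irreducibleComponent x,
        ⟨irreducibleComponent_mem_irreducibleComponents x, ?_⟩, mem_irreducibleComponent⟩⟩
    exact fun h ↦ hxZ (h ▸ mem_irreducibleComponent)
  rw [h, isOpen_compl_iff, Set.sUnion_eq_biUnion]
  exact (TopologicalSpace.NoetherianSpace.finite_irreducibleComponents.subset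
    Set.sdiff_subset).isClosed_biUnion fun W hW ↦ isClosed_of_mem_irreducibleComponents W hW.1

end Components

/-! ### Points of curves with values in fields. -/

section SpecOver

variable {k : Type u} [Field k]

theorem specMap_injective {E F : Type u} [Field E] [Algebra k E] [Field F] [Algebra k F]
    {φ ψ : E →ₐ[k] F} (h : specMap φ = specMap ψ) : φ = ψ := by
  have h' := congrArg Over.Hom.left h
  ext x
  exact congrArg (fun χ ↦ χ.hom x) (Spec.map_injective h')

theorem specMap_comp {E F G : Type u} [Field E] [Algebra k E] [Field F] [Algebra k F] [Field G]
    [Algebra k G] (φ : E →ₐ[k] F) (ψ : F →ₐ[k] G) :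
    specMap ψ ≫ specMap φ = specMap (ψ.comp φ) := by
  ext1
  simp only [Over.homMk_left, Over.comp_left, ← Spec.map_comp, ← CommRingCat.ofHom_comp]
  rfl

theorem exists_specMap_eq {E F : Type u} [Field E] [Algebra k E] [Field F] [Algebra k F]
    (p : specOver k F ⟶ specOver k E) : ∃ φ : E →ₐ[k] F, specMap φ = p := by
  obtain ⟨χ, hχ⟩ := Spec.map_surjective p.left
  have h : CommRingCat.ofHom (algebraMap k E) ≫ χ = CommRingCat.ofHom (algebraMap k F) := by
    apply Spec.map_injective
    rw [Spec.map_comp, hχ]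
    exact Over.w p
  refine ⟨{ χ.hom with commutes' := fun c ↦ congrArg (fun f ↦ f.hom c) h }, ?_⟩
  ext1
  exact hχ

variable {C : Over (Spec (.of k))} [IsSmoothProjectiveCurve C]

instance mono_inclusion (x : ClosedPoint C) : Mono (inclusion x) := by
  have : Mono (inclusion x).left := inferInstanceAs (Mono (C.left.fromSpecResidueField x.1))
  exact Over.mono_of_mono_left _

/-- The point of a curve that underlies a point over a field. -/
def specPoint {D : Over (Spec (.of k))} {F : Type u} [Field F] [Algebra k F]
    (p : specOver k F ⟶ D) : D.left :=
  p.left (IsLocalRing.closedPoint F)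

theorem range_left_specOver {D : Over (Spec (.of k))} {F : Type u} [Field F] [Algebra k F]
    (p : specOver k F ⟶ D) : Set.range p.left = {specPoint p} := by
  have (y : Spec (.of F)) : y = IsLocalRing.closedPoint F := Subsingleton.elim _ _
  ext z
  constructor
  · rintro ⟨y, rfl⟩
    rw [this y]
    rfl
  · rintro rfl
    exact ⟨_, rfl⟩

theorem specPoint_comp {D D' : Over (Spec (.of k))} {F : Type u} [Field F] [Algebra k F]
    (p : specOver k F ⟶ D) (q : D ⟶ D') : specPoint (p ≫ q) = q.left (specPoint p) :=
  rfl

theorem specPoint_specMap_comp {D : Over (Spec (.of k))} {E F : Type u} [Field E] [Algebra k E]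
    [Field F] [Algebra k F] (φ : E →ₐ[k] F) (p : specOver k E ⟶ D) :
    specPoint (specMap φ ≫ p) = specPoint p :=
  congrArg p.left (Subsingleton.elim (α := Spec (.of E)) _ _)

theorem specPoint_inclusion (x : ClosedPoint C) : specPoint (inclusion x) = x.1 :=
  C.left.fromSpecResidueField_apply x.1 _

/-- The composite `Spec F → C → Spec k` is finite, so `Spec F → C` is proper and has closed image.
-/
theorem isClosed_specPoint (F : FinExt k) (p : specOver k F ⟶ C) : IsClosed {specPoint p} := by
  rw [← range_left_specOver]
  have : IsFinite (p.left ≫ C.hom) := by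
    rw [Over.w p]
    refine (IsFinite.SpecMap_iff _).mpr ?_
    rw [CommRingCat.hom_ofHom, RingHom.finite_algebraMap]
    infer_instance
  have : IsProper p.left := IsProper.of_comp p.left C.hom
  exact p.left.isClosedMap.isClosed_range

/-- A point over a field factors through the residue field of the underlying closed point. -/
theorem exists_specMap_inclusion_eq {F : Type u} [Field F] [Algebra k F] (p : specOver k F ⟶ C)
    (x : ClosedPoint C) (h : specPoint p = x.1) :
    ∃ φ : residueExt x →ₐ[k] F, specMap φ ≫ inclusion x = p := by
  obtain ⟨⟨y, ψ⟩, hψ⟩ := (Scheme.SpecToEquivOfField F C.left).symm.surjective p.left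
  have hψ' : Spec.map ψ ≫ C.left.fromSpecResidueField y = p.left := hψ
  obtain rfl : y = x.1 := by
    rw [← h, specPoint, ← hψ']
    exact (C.left.fromSpecResidueField_apply _ _).symm
  let q : specOver k F ⟶ specOver k (residueExt x) := Over.homMk (Spec.map ψ) (by
    rw [← Over.w p, ← hψ', ← Over.w (inclusion x), Category.assoc]
    rfl)
  obtain ⟨φ, hφ⟩ := exists_specMap_eq q
  refine ⟨φ, ?_⟩
  rw [hφ]
  ext1
  exact hψ'

end SpecOver

/-! ### The base change of a curve to `L` and its components. -/

section BaseChange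

open Limits

variable {k : Type u} [Field k] (C : Over (Spec (.of k))) (L : FinExt k)

/-- The base change `C ×_k L`, viewed as a `k`-scheme. -/
def curveBaseChange : Over (Spec (.of k)) :=
  Over.mk (pullback.fst C.hom (specOver k L).hom ≫ C.hom)

/-- The projection `C ×_k L ⟶ C`. -/
def curveBaseChangeFst : curveBaseChange C L ⟶ C :=
  Over.homMk (pullback.fst C.hom (specOver k L).hom)

/-- The projection `C ×_k L ⟶ Spec L`. -/
def curveBaseChangeSnd : curveBaseChange C L ⟶ specOver k L :=
  Over.homMk (pullback.snd C.hom (specOver k L).hom) pullback.condition.symm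

variable {C L} in
theorem exists_curveBaseChange_lift {T : Over (Spec (.of k))} (a : T ⟶ C) (b : T ⟶ specOver k L) :
    ∃ p : T ⟶ curveBaseChange C L,
      p ≫ curveBaseChangeFst C L = a ∧ p ≫ curveBaseChangeSnd C L = b := by
  have h : a.left ≫ C.hom = b.left ≫ (specOver k L).hom := by rw [Over.w, Over.w]
  refine ⟨Over.homMk (pullback.lift a.left b.left h) ?_, ?_, ?_⟩
  · exact (pullback.lift_fst_assoc _ _ _ _).trans (Over.w a)
  · ext1
    exact pullback.lift_fst _ _ _
  · ext1
    exact pullback.lift_snd _ _ _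

variable {C L} in
theorem curveBaseChange_hom_ext {T : Over (Spec (.of k))} {p q : T ⟶ curveBaseChange C L}
    (h₁ : p ≫ curveBaseChangeFst C L = q ≫ curveBaseChangeFst C L)
    (h₂ : p ≫ curveBaseChangeSnd C L = q ≫ curveBaseChangeSnd C L) : p = q := by
  ext1
  exact pullback.hom_ext (congrArg Over.Hom.left h₁) (congrArg Over.Hom.left h₂)

variable [IsSmoothProjectiveCurve C]

instance isFinite_specOver : IsFinite (specOver k L).hom := by
  refine (IsFinite.SpecMap_iff _).mpr ?_
  rw [CommRingCat.hom_ofHom, RingHom.finite_algebraMap]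
  infer_instance

instance isFinite_curveBaseChangeFst : IsFinite (curveBaseChangeFst C L).left :=
  inferInstanceAs (IsFinite (pullback.fst C.hom (specOver k L).hom))

instance isNoetherian_curveBaseChange : IsNoetherian (curveBaseChange C L).left where
  toIsLocallyNoetherian :=
    LocallyOfFiniteType.isLocallyNoetherian (curveBaseChangeFst C L).left
  toCompactSpace := by
    have : CompactSpace C.left := QuasiCompact.compactSpace_of_compactSpace C.hom
    exact QuasiCompact.compactSpace_of_compactSpace (curveBaseChangeFst C L).left

variable [PerfectField k]

/-- Perfectness of `k` makes `L / k` separable; étaleness of `C ×_k L → C` follows by base change.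
-/
instance etale_specOver : Etale (specOver k L).hom := by
  refine (HasRingHomProperty.Spec_iff (P := @Etale)).mpr ?_
  rw [CommRingCat.hom_ofHom, RingHom.etale_algebraMap]
  have : Algebra.FormallyEtale k L := Algebra.FormallyEtale.of_isSeparable k L
  exact ⟨this, Algebra.FinitePresentation.of_finiteType.mp inferInstance⟩

instance etale_curveBaseChangeFst : Etale (curveBaseChangeFst C L).left :=
  inferInstanceAs (Etale (pullback.fst C.hom (specOver k L).hom))

instance isDomain_stalk_curveBaseChange (y : (curveBaseChange C L).left) :
    IsDomain ((curveBaseChange C L).left.presheaf.stalk y) :=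
  isDomain_stalk (curveBaseChangeFst C L).left y (isPrincipal_maximalIdeal_stalk_curve C _)

variable (Z : irreducibleComponents (curveBaseChange C L).left)

/-- An irreducible component of `C ×_k L`, as an open subscheme. -/
def componentOpen : (curveBaseChange C L).left.Opens :=
  ⟨Z.1, isOpen_of_mem_irreducibleComponents Z.2⟩

/-- An irreducible component of `C ×_k L`, as a `k`-scheme. -/
def component : Over (Spec (.of k)) :=
  Over.mk ((componentOpen C L Z).ι ≫ (curveBaseChange C L).hom)

/-- The inclusion of an irreducible component in `C ×_k L`. -/
def componentι : component C L Z ⟶ curveBaseChange C L :=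
  Over.homMk (componentOpen C L Z).ι

instance isOpenImmersion_componentι : IsOpenImmersion (componentι C L Z).left :=
  inferInstanceAs (IsOpenImmersion (componentOpen C L Z).ι)

theorem range_componentι : Set.range (componentι C L Z).left = Z.1 :=
  (componentOpen C L Z).range_ι

instance isClosedImmersion_componentι : IsClosedImmersion (componentι C L Z).left := by
  refine .of_isPreimmersion _ ?_
  rw [range_componentι]
  exact isClosed_of_mem_irreducibleComponents _ Z.2

/-- The projection from an irreducible component of `C ×_k L` to `C`. -/
def componentFst : component C L Z ⟶ C :=
  componentι C L Z ≫ curveBaseChangeFst C L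

instance etale_componentFst : Etale (componentFst C L Z).left :=
  inferInstanceAs (Etale ((componentι C L Z).left ≫ (curveBaseChangeFst C L).left))

instance isFinite_componentFst : IsFinite (componentFst C L Z).left :=
  inferInstanceAs (IsFinite ((componentι C L Z).left ≫ (curveBaseChangeFst C L).left))

/-- The projection from an irreducible component of `C ×_k L` to `Spec L`. -/
def componentSnd : component C L Z ⟶ specOver k L :=
  componentι C L Z ≫ curveBaseChangeSnd C L

instance isSmoothProjectiveCurve_component : IsSmoothProjectiveCurve (component C L Z) where
  isIntegral := by
    have : IsReduced (curveBaseChange C L).left := isReduced_of_isReduced_stalk _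
    have : IsReduced (component C L Z).left :=
      isReduced_of_isOpenImmersion (componentι C L Z).left
    have : IrreducibleSpace (component C L Z).left :=
      (Subtype.irreducibleSpace Z.2.1)
    exact isIntegral_of_irreducibleSpace_of_isReduced _
  isProper := by
    rw [← Over.w (componentFst C L Z)]
    infer_instance
  smooth := by
    rw [← Over.w (componentFst C L Z)]
    -- The étale projection to `C` contributes relative dimension 0, and `C` contributes 1.
    exact inferInstanceAs (SmoothOfRelativeDimension (0 + 1) _)

variable {C L} in
theorem closedPoint_component_ext
    {p q : Σ Z : irreducibleComponents (curveBaseChange C L).left, ClosedPoint (component C L Z)}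
    (h : (componentι C L p.1).left p.2.1 = (componentι C L q.1).left q.2.1) : p = q := by
  obtain ⟨Z, y⟩ := p
  obtain ⟨Z', y'⟩ := q
  obtain rfl : Z = Z' := Subtype.ext <| eq_of_mem_irreducibleComponents Z.2 Z'.2
    (range_componentι C L Z ▸ Set.mem_range_self y.1)
    (h ▸ range_componentι C L Z' ▸ Set.mem_range_self y'.1)
  obtain rfl : y = y' := Subtype.ext ((componentι C L Z).left.isOpenEmbedding.injective h)
  rfl

end BaseChange

/-! ### Closed points of the components and factors of `k(x) ⊗ L`. -/

section ComponentPoints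

variable {k : Type u} [Field k] [PerfectField k] {C : Over (Spec (.of k))}
  [IsSmoothProjectiveCurve C] {L : FinExt k}

/-- Every factor of `k(x) ⊗_k L` is the residue field of a closed point above `x` of a component
of `C ×_k L`. -/
theorem exists_component_point (x : ClosedPoint C) (j : FactorIndex (residueExt x) L) :
    ∃ (Z : irreducibleComponents (curveBaseChange C L).left) (y : ClosedPoint (component C L Z))
      (e : residueExt y ≃ₐ[k] factor j),
      specMap e.toAlgHom ≫ inclusion y ≫ componentFst C L Z =
        specMap (factorLeft j) ≫ inclusion x ∧
      specMap e.toAlgHom ≫ inclusion y ≫ componentSnd C L Z = specMap (factorRight j) := by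
  -- The two maps from `Spec L_j` to `C` and to `Spec L` give a point of `C ×_k L`; `y` is this
  -- point on its component.
  obtain ⟨p, hp₁, hp₂⟩ := exists_curveBaseChange_lift (specMap (factorLeft j) ≫ inclusion x)
    (specMap (factorRight j))
  let Z : irreducibleComponents (curveBaseChange C L).left :=
    ⟨irreducibleComponent (specPoint p), irreducibleComponent_mem_irreducibleComponents _⟩
  obtain ⟨q, hq⟩ : ∃ q : specOver k (factor j) ⟶ component C L Z, q ≫ componentι C L Z = p := by
    have hr : Set.range p.left ⊆ Set.range (componentι C L Z).left := by
      rw [range_left_specOver, range_componentι, Set.singleton_subset_iff]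
      exact mem_irreducibleComponent
    have hfac := IsOpenImmersion.lift_fac (componentι C L Z).left p.left hr
    refine ⟨Over.homMk (IsOpenImmersion.lift (componentι C L Z).left p.left hr) ?_, ?_⟩
    · rw [← Over.w (componentι C L Z), reassoc_of% hfac, Over.w p]
    · ext1
      exact hfac
  let y : ClosedPoint (component C L Z) := ⟨specPoint q, isClosed_specPoint (factor j) q⟩
  obtain ⟨φ, hφ⟩ := exists_specMap_inclusion_eq q y rfl
  have h₁ : specMap φ ≫ inclusion y ≫ componentFst C L Z =
      specMap (factorLeft j) ≫ inclusion x := by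
    rw [componentFst, reassoc_of% hφ, reassoc_of% hq, hp₁]
  have h₂ : specMap φ ≫ inclusion y ≫ componentSnd C L Z = specMap (factorRight j) := by
    rw [componentSnd, reassoc_of% hφ, reassoc_of% hq, hp₂]
  obtain ⟨ψ, hψ⟩ := exists_specMap_inclusion_eq (inclusion y ≫ componentFst C L Z) x (by
    rw [← specPoint_specMap_comp φ, h₁, specPoint_specMap_comp, specPoint_inclusion])
  obtain ⟨ψ', hψ'⟩ := exists_specMap_eq (inclusion y ≫ componentSnd C L Z)
  have hl : φ.comp ψ = factorLeft j := by
    apply specMap_injective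
    rw [← specMap_comp, ← cancel_mono (inclusion x), Category.assoc, hψ, h₁]
  have hr : φ.comp ψ' = factorRight j := by
    apply specMap_injective
    rw [← specMap_comp, hψ', h₂]
  have hlift : φ.comp (tensorLift ψ ψ') = factorMk j :=
    Algebra.TensorProduct.ext
      (Eq.trans (b := φ.comp ψ) (AlgHom.ext fun a ↦ congrArg φ (tensorLift_tmul_one ψ ψ' a)) hl)
      (Eq.trans (b := φ.comp ψ') (AlgHom.ext fun b ↦ congrArg φ (tensorLift_one_tmul ψ ψ' b)) hr)
  -- The projection `k(x) ⊗ L → L_j` factors through `k(y)`, so `k(y) → L_j` is onto.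
  have hsurj : Function.Surjective φ := fun a ↦ by
    obtain ⟨t, rfl⟩ := factorMk_surjective j a
    exact ⟨_, DFunLike.congr_fun hlift t⟩
  exact ⟨Z, y, AlgEquiv.ofBijective φ ⟨φ.injective, hsurj⟩, h₁, h₂⟩

/-- The closed point of a component of `C ×_k L` attached to a factor of `k(x) ⊗_k L`. -/
def componentPoint (t : Σ x : ClosedPoint C, FactorIndex (residueExt x) L) :
    Σ Z : irreducibleComponents (curveBaseChange C L).left, ClosedPoint (component C L Z) :=
  ⟨(exists_component_point t.1 t.2).choose, (exists_component_point t.1 t.2).choose_spec.choose⟩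

theorem componentPoint_spec (t : Σ x : ClosedPoint C, FactorIndex (residueExt x) L) :
    ∃ e : residueExt (componentPoint t).2 ≃ₐ[k] factor t.2,
      specMap e.toAlgHom ≫ inclusion (componentPoint t).2 ≫ componentFst C L (componentPoint t).1 =
        specMap (factorLeft t.2) ≫ inclusion t.1 ∧
      specMap e.toAlgHom ≫ inclusion (componentPoint t).2 ≫ componentSnd C L (componentPoint t).1 =
        specMap (factorRight t.2) :=
  (exists_component_point t.1 t.2).choose_spec.choose_spec

theorem componentFst_componentPoint (t : Σ x : ClosedPoint C, FactorIndex (residueExt x) L) :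
    (componentFst C L (componentPoint t).1).left (componentPoint t).2.1 = t.1.1 := by
  obtain ⟨e, h₁, -⟩ := componentPoint_spec t
  have := congrArg specPoint h₁
  rwa [specPoint_specMap_comp, specPoint_specMap_comp, specPoint_comp, specPoint_inclusion,
    specPoint_inclusion] at this

/-- If two factors give the same point `y`, both are isomorphic to `k(y)` compatibly with `k(x)` and
`L`, so they are quotients of `k(x) ⊗ L` by the same kernel. -/
theorem componentPoint_injective : Function.Injective (componentPoint (C := C) (L := L)) := by
  rintro ⟨x, j⟩ ⟨x', j'⟩ h
  obtain rfl : x = x' := by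
    apply Subtype.ext
    rw [← componentFst_componentPoint ⟨x, j⟩, h, componentFst_componentPoint]
  -- Generalizing the point to `p` allows the isomorphism to be transported along `h`.
  have key (p : Σ Z : irreducibleComponents (curveBaseChange C L).left,
      ClosedPoint (component C L Z)) (hp : componentPoint ⟨x, j'⟩ = p) :
      ∃ e : residueExt p.2 ≃ₐ[k] factor j',
        specMap e.toAlgHom ≫ inclusion p.2 ≫ componentFst C L p.1 =
          specMap (factorLeft j') ≫ inclusion x ∧
        specMap e.toAlgHom ≫ inclusion p.2 ≫ componentSnd C L p.1 = specMap (factorRight j') :=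
    hp ▸ componentPoint_spec ⟨x, j'⟩
  obtain ⟨e, h₁, h₂⟩ := componentPoint_spec ⟨x, j⟩
  obtain ⟨e', h₁', h₂'⟩ := key _ h.symm
  let θ : factor j →ₐ[k] factor j' := e'.toAlgHom.comp e.symm.toAlgHom
  have hθ : specMap e'.toAlgHom = specMap θ ≫ specMap e.toAlgHom := by
    rw [specMap_comp]
    congr 1
    ext a
    exact congrArg e' (e.symm_apply_apply a).symm
  have hl : θ.comp (factorLeft j) = factorLeft j' := by
    apply specMap_injective
    rw [← cancel_mono (inclusion x), ← h₁', hθ, Category.assoc, h₁, ← specMap_comp, Category.assoc]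
  have hr : θ.comp (factorRight j) = factorRight j' := by
    apply specMap_injective
    rw [← h₂', hθ, Category.assoc, h₂, specMap_comp]
  have hmk : θ.comp (factorMk j) = factorMk j' := Algebra.TensorProduct.ext hl hr
  obtain rfl : j = j' := by
    rw [← kerFactor_comp_factorMk j θ, hmk]
    exact kerFactor_comp_factorMk j' (AlgHom.id k _)
  rfl

/-- The maps from `k(x)` and `L` to `k(y)` define a map on `k(x) ⊗ L`, whose kernel is the factor
`j`. The point attached to `j` and `y` coincide in `C ×_k L` because both projections agree. -/
theorem exists_componentPoint_eq (Z : irreducibleComponents (curveBaseChange C L).left)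
    (y : ClosedPoint (component C L Z)) (x : ClosedPoint C)
    (h : (componentFst C L Z).left y.1 = x.1) :
    ∃ j : FactorIndex (residueExt x) L, componentPoint ⟨x, j⟩ = ⟨Z, y⟩ := by
  obtain ⟨ψ, hψ⟩ := exists_specMap_inclusion_eq (inclusion y ≫ componentFst C L Z) x (by
    rw [specPoint_comp, specPoint_inclusion, h])
  obtain ⟨ψ', hψ'⟩ := exists_specMap_eq (inclusion y ≫ componentSnd C L Z)
  let f : (residueExt x ⊗[k] L) →ₐ[k] residueExt y := tensorLift ψ ψ'
  let τ : factor (kerFactor f) →ₐ[k] residueExt y :=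
    factorLift _ f fun t ht ↦ (mem_kerFactor f t).mp ht
  have hl : τ.comp (factorLeft (kerFactor f)) = ψ := AlgHom.ext (tensorLift_tmul_one ψ ψ')
  have hr : τ.comp (factorRight (kerFactor f)) = ψ' := AlgHom.ext (tensorLift_one_tmul ψ ψ')
  refine ⟨kerFactor f, ?_⟩
  obtain ⟨e, h₁, h₂⟩ := componentPoint_spec ⟨x, kerFactor f⟩
  have key : specMap τ ≫ specMap e.toAlgHom ≫ inclusion (componentPoint ⟨x, kerFactor f⟩).2 ≫
      componentι C L (componentPoint ⟨x, kerFactor f⟩).1 = inclusion y ≫ componentι C L Z := by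
    refine curveBaseChange_hom_ext ?_ ?_
    · simp only [Category.assoc]
      rw [componentFst] at h₁ hψ
      rw [h₁, ← hψ, ← Category.assoc, specMap_comp, hl]
    · simp only [Category.assoc]
      rw [componentSnd] at h₂ hψ'
      rw [h₂, ← hψ', specMap_comp, hr]
  have hpt := congrArg specPoint key
  rw [specPoint_specMap_comp, specPoint_specMap_comp, specPoint_comp, specPoint_comp,
    specPoint_inclusion, specPoint_inclusion] at hpt
  exact closedPoint_component_ext hpt

end ComponentPoints

/-! ### Weil reciprocity for the sum over the factors. -/

section WeilReciprocity

variable {k : Type u} [Field k] [PerfectField k] {n m : ℕ} (A : Fin (n + m) → AbelianVariety k)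
  (L : FinExt k)

/-- Weil reciprocity in the `K`-group. -/
theorem sum_ord_smul_symbol {I : Type} [DecidableEq I] (A : I → AbelianVariety k)
    (C : Over (Spec (.of k))) [hC : IsSmoothProjectiveCurve C] (g : ∀ i, C ⟶ (A i).scheme)
    (t : C.left.functionField) (S : Finset (ClosedPoint C)) (ht : t ≠ 0)
    (hS : ∀ x : ClosedPoint C, Scheme.ord t x.1 ≠ 0 → x ∈ S) :
    ∑ x ∈ S, Scheme.ord t x.1 •
      symbol A (residueExt x) (fun i ↦ .ofHom (inclusion x ≫ g i)) = 0 := by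
  have h := (QuotientAddGroup.eq_zero_iff _).mpr
    (AddSubgroup.subset_closure ⟨C, hC, g, t, S, ht, hS, rfl⟩ : _ ∈ weilReciprocity A)
  exact (map_sum (QuotientAddGroup.mk' (weilReciprocity A)) _ _).symm.trans h

variable {C : Over (Spec (.of k))} [IsSmoothProjectiveCurve C]

/-- The morphisms `g_1, …, g_n, b_1, …, b_m` on a component of `C ×_k L`. -/
def componentMaps (g : ∀ i, C ⟶ (A (Fin.castAdd m i)).scheme)
    (b : ∀ i, (A (Fin.natAdd n i)).Point L) (Z : irreducibleComponents (curveBaseChange C L).left) :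
    ∀ i, component C L Z ⟶ (A i).scheme :=
  Fin.addCases (motive := fun i ↦ component C L Z ⟶ (A i).scheme)
    (fun i ↦ componentFst C L Z ≫ g i) (fun i ↦ componentSnd C L Z ≫ (b i).toHom)

/-- The residue field of the point is isomorphic to the factor compatibly with both projections, and
symbols are invariant under isomorphism. `NeZero (n + m)` supplies the place needed for that
invariance. -/
theorem symbol_componentPoint [NeZero (n + m)] (g : ∀ i, C ⟶ (A (Fin.castAdd m i)).scheme)
    (b : ∀ i, (A (Fin.natAdd n i)).Point L)
    (t : Σ x : ClosedPoint C, FactorIndex (residueExt x) L) :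
    symbol A (residueExt (componentPoint t).2) (fun i ↦
        .ofHom (inclusion (componentPoint t).2 ≫ componentMaps A L g b (componentPoint t).1 i)) =
      symbol A (factor t.2)
        (factorPoints A L t.2 (fun i ↦ .ofHom (inclusion t.1 ≫ g i)) b) := by
  obtain ⟨e, h₁, h₂⟩ := componentPoint_spec t
  rw [← symbol_res_algEquiv A e]
  congr 1
  funext i
  refine Fin.addCases (fun i ↦ ?_) (fun i ↦ ?_) i
  · rw [factorPoints, Fin.addCases_left, componentMaps, Fin.addCases_left]
    refine congrArg AbelianVariety.Point.ofHom ?_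
    change specMap e.toAlgHom ≫ inclusion (componentPoint t).2 ≫ componentFst C L _ ≫ g i =
      specMap (factorLeft t.2) ≫ inclusion t.1 ≫ g i
    simp only [← Category.assoc] at h₁ ⊢
    rw [h₁]
  · rw [factorPoints, Fin.addCases_right, componentMaps, Fin.addCases_right]
    refine congrArg AbelianVariety.Point.ofHom ?_
    change specMap e.toAlgHom ≫ inclusion (componentPoint t).2 ≫ componentSnd C L _ ≫ (b i).toHom =
      specMap (factorRight t.2) ≫ (b i).toHom
    rw [← h₂]
    simp only [Category.assoc]

/-- Pairs of a point `x` and a factor of `k(x) ⊗ L` are regrouped as closed points of the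
components; on each component the sum vanishes by Weil reciprocity for the pulled back data. -/
theorem sum_ord_smul_factorSum [NeZero (n + m)] (g : ∀ i, C ⟶ (A (Fin.castAdd m i)).scheme)
    (f : C.left.functionField) (S : Finset (ClosedPoint C)) (hf : f ≠ 0)
    (hS : ∀ x : ClosedPoint C, Scheme.ord f x.1 ≠ 0 → x ∈ S) :
    ∑ x ∈ S, Scheme.ord f x.1 •
      factorSum A L (residueExt x) (fun i ↦ .ofHom (inclusion x ≫ g i)) = 0 := by
  classical
  ext b
  let _ : Fintype (irreducibleComponents (curveBaseChange C L).left) :=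
    TopologicalSpace.NoetherianSpace.finite_irreducibleComponents.fintype
  let f' (Z : irreducibleComponents (curveBaseChange C L).left) :
      (component C L Z).left.functionField := (functionFieldMap (componentFst C L Z).left).hom f
  have hord (Z : irreducibleComponents (curveBaseChange C L).left) (y : (component C L Z).left) :
      Scheme.ord (f' Z) y = Scheme.ord f ((componentFst C L Z).left y) :=
    ord_functionFieldMap _ y (isPrincipal_maximalIdeal_stalk_curve C _) f
  let G (p : Σ Z : irreducibleComponents (curveBaseChange C L).left,
      ClosedPoint (component C L Z)) : KGroup A :=
    Scheme.ord (f' p.1) p.2.1 • symbol A (residueExt p.2)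
      (fun i ↦ .ofHom (inclusion p.2 ≫ componentMaps A L g b p.1 i))
  let T := (S.sigma fun x ↦ (Finset.univ : Finset (FactorIndex (residueExt x) L)))
  -- `S' Z` consists of the points on `Z` that come from pairs `(x, j)` with `x` in `S`. It contains
  -- every point where `f' Z` has nonzero order, since such a point lies above some `x` in `S`.
  let S' (Z : irreducibleComponents (curveBaseChange C L).left) :
      Finset (ClosedPoint (component C L Z)) :=
    (T.image componentPoint).preimage (fun y ↦ ⟨Z, y⟩) fun _ _ _ _ h ↦
      eq_of_heq (Sigma.mk.inj h).2
  have hT : T.image componentPoint = Finset.univ.sigma S' := by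
    ext p
    exact ⟨fun h ↦ Finset.mem_sigma.mpr ⟨Finset.mem_univ _, Finset.mem_preimage.mpr h⟩,
      fun h ↦ Finset.mem_preimage.mp (Finset.mem_sigma.mp h).2⟩
  have hZ (Z : irreducibleComponents (curveBaseChange C L).left) :
      ∑ y ∈ S' Z, G ⟨Z, y⟩ = 0 := by
    refine sum_ord_smul_symbol A (component C L Z) (componentMaps A L g b Z) (f' Z) (S' Z)
      ((map_ne_zero _).mpr hf) fun y hy ↦ ?_
    rw [hord] at hy
    let x : ClosedPoint C := ⟨(componentFst C L Z).left y.1, by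
      have := (componentFst C L Z).left.isClosedMap _ y.2
      rwa [Set.image_singleton] at this⟩
    obtain ⟨j, hj⟩ := exists_componentPoint_eq Z y x rfl
    refine Finset.mem_preimage.mpr ?_
    rw [← hj]
    exact Finset.mem_image_of_mem _ (Finset.mem_sigma.mpr ⟨hS x hy, Finset.mem_univ _⟩)
  have hG (t : Σ x : ClosedPoint C, FactorIndex (residueExt x) L) :
      G (componentPoint t) = Scheme.ord f t.1.1 • symbol A (factor t.2)
        (factorPoints A L t.2 (fun i ↦ .ofHom (inclusion t.1 ≫ g i)) b) := by
    rw [← symbol_componentPoint, ← componentFst_componentPoint t, ← hord]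
  calc _ = ∑ x ∈ S, Scheme.ord f x.1 • ∑ j : FactorIndex (residueExt x) L, symbol A (factor j)
        (factorPoints A L j (fun i ↦ .ofHom (inclusion x ≫ g i)) b) := by
        rw [_root_.sum_apply]
        rfl
    _ = ∑ t ∈ T, G (componentPoint t) := by
        simp_rw [Finset.smul_sum, hG]
        exact Finset.sum_sigma' _ _ _
    _ = ∑ p ∈ Finset.univ.sigma S', G p := by
        rw [← hT, Finset.sum_image componentPoint_injective.injOn]
    _ = ∑ Z, ∑ y ∈ S' Z, G ⟨Z, y⟩ := Finset.sum_sigma _ _ _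
    _ = 0 := Finset.sum_eq_zero fun Z _ ↦ hZ Z

end WeilReciprocity

/-! ### Homomorphisms on `K ⊗ ⨂ N i`. -/

section TensorLift

variable {I : Type} {K M : Type*} {N : I → Type*} [AddCommGroup K] [AddCommGroup M]
  [∀ i, AddCommGroup (N i)]

/-- The hypothesis `hs` expresses, through homomorphisms to `M`, that the `s j` generate `K`. -/
theorem tensor_tprod_hom_ext {J : Type*} {s : J → K}
    (hs : ∀ f g : K →+ M, (∀ j, f (s j) = g (s j)) → f = g)
    {Φ Ψ : K ⊗[ℤ] (⨂[ℤ] i, N i) →+ M}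
    (h : ∀ j b, Φ (s j ⊗ₜ PiTensorProduct.tprod ℤ b) = Ψ (s j ⊗ₜ PiTensorProduct.tprod ℤ b)) :
    Φ = Ψ := by
  have h₁ (b : ∀ i, N i) :
      Φ.comp ((TensorProduct.mk ℤ K _).flip (PiTensorProduct.tprod ℤ b)).toAddMonoidHom =
        Ψ.comp ((TensorProduct.mk ℤ K _).flip (PiTensorProduct.tprod ℤ b)).toAddMonoidHom :=
    hs _ _ fun j ↦ h j b
  have h₂ : Φ.toIntLinearMap = Ψ.toIntLinearMap := TensorProduct.ext <| LinearMap.ext fun x ↦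
    PiTensorProduct.ext <| MultilinearMap.ext fun b ↦ DFunLike.congr_fun (h₁ b) x
  exact AddMonoidHom.ext fun x ↦ DFunLike.congr_fun h₂ x

/-- A homomorphism from `K` to multilinear maps induces one from the tensor product. -/
theorem exists_tensor_tprod_lift (Ψ : K →+ MultilinearMap ℤ N M) :
    ∃ Φ : K ⊗[ℤ] (⨂[ℤ] i, N i) →+ M, ∀ x b, Φ (x ⊗ₜ PiTensorProduct.tprod ℤ b) = Ψ x b :=
  ⟨(TensorProduct.lift
      (PiTensorProduct.lift.toLinearMap.comp Ψ.toIntLinearMap)).toAddMonoidHom,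
    fun x b ↦ PiTensorProduct.lift.tprod (φ := Ψ x) b⟩

end TensorLift

end Somekawa

end

/-! ### The proposition. -/

open Somekawa
theorem proposition3p1 {k : Type u} [Field k] [PerfectField k] (m : ℕ) (hm : 1 ≤ m)
    (A : Fin (2 + m) → AbelianVariety k) (L : FinExt k) :
    ∃! Φ : KGroup (fun i : Fin 2 ↦ A (Fin.castAdd m i)) ⊗[ℤ]
        (⨂[ℤ] j : Fin m, (A (Fin.natAdd 2 j)).Point L) →+ KGroup A,
      ∀ (F : FinExt k) (a : ∀ i : Fin 2, (A (Fin.castAdd m i)).Point F)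
        (b : ∀ j : Fin m, (A (Fin.natAdd 2 j)).Point L),
        Φ (symbol (fun i : Fin 2 ↦ A (Fin.castAdd m i)) F a ⊗ₜ[ℤ] PiTensorProduct.tprod ℤ b) =
          ∑ j : FactorIndex F L, symbol A (factor j)
            (Fin.addCases (motive := fun i ↦ (A i).Point (factor j))
              (fun i ↦ AbelianVariety.res (factorLeft j) (a i))
              (fun i ↦ AbelianVariety.res (factorRight j) (b i))) := by
  -- The target is the group of multilinear maps in `b`, so all `b` are treated at once.
  obtain ⟨Ψ, hΨ⟩ := KGroup.exists_lift (fun i : Fin 2 ↦ A (Fin.castAdd m i)) (factorSum A L)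
    (fun E F φ i x a ↦ factorSum_update_norm A L φ i x a)
    (fun C hC g t S ht hS ↦ sum_ord_smul_factorSum A L g t S ht hS)
  obtain ⟨Φ, hΦ⟩ := exists_tensor_tprod_lift Ψ
  have h (F : FinExt k) (a : ∀ i : Fin 2, (A (Fin.castAdd m i)).Point F)
      (b : ∀ j : Fin m, (A (Fin.natAdd 2 j)).Point L) :=
    (hΦ (symbol _ F a) b).trans (DFunLike.congr_fun (hΨ F a) b)
  refine ⟨Φ, h, fun Φ' hΦ' ↦ ?_⟩
  exact tensor_tprod_hom_ext (J := Σ F : FinExt k, ∀ i : Fin 2, (A (Fin.castAdd m i)).Point F)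
    (s := fun p ↦ symbol _ p.1 p.2) (fun f g hfg ↦ KGroup.hom_ext fun F a ↦ hfg ⟨F, a⟩)
    fun p b ↦ (hΦ' p.1 p.2 b).trans (h p.1 p.2 b).symm
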